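/- A lattice is a free abelian group of finite rank with a nondegenerate symmetric integral bilinear form $(\cdot,\cdot)$; it is even if $(x,x)\in 2\mathbb{Z}$ for all $x$. For an even lattice $M$ of signature $(2,m)$ let $M^\vee=\{v\in M\otimes\mathbb{Q} : (v,M)\subset\mathbb{Z}\}$, let $D(M)=M^\vee/M$ be the discriminant group with the quadratic form $x\mapsto (x,x)\in\mathbb{Q}/2\mathbb{Z}$, and let $\mathrm{O}(D(M))$ be the group of automorphisms of $D(M)$ preserving this form. Let $\mathrm{O}(M)$ be the group of isometries of $M$, $\mathrm{O}^+(M)\subset \mathrm{O}(M)$ the subgroup of isometries preserving the orientation of positive $2$-planes in $M\otimes\mathbb{R}$, $\widetilde{\mathrm{O}}(M)$ the group of isometries acting trivially on $D(M)$, and $\widetilde{\mathrm{O}}^+(M)=\mathrm{O}^+(M)\cap\widetilde{\mathrm{O}}(M)$. Let $\Omega(M)$ be one of the two connected components of $\{[w]\in\mathbb{P}(M\otimes\mathbb{C}) : (w,w)=0,\ (w,\overline{w})>0\}$. Let $\Lambda$ and $\Lambda_\#$ be even lattices of signatures $(2,m)$ and $(2,m')$ with $3\le m\le m'$, and let $\Lambda\hookrightarrow\Lambda_\#$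 be an embedding of lattices, not necessarily primitive; let $\Omega(\Lambda_\#)$ be the component that contains the image of $\Omega(\Lambda)$. Let $\Lambda_s=\{y\in\Lambda_\# : ny\in\Lambda\text{ for some integer } n\neq 0\}$ be the saturation of $\Lambda$ in $\Lambda_\#$. Let $\Gamma\subset \mathrm{O}^+(\Lambda)$ be a subgroup of finite index which is extendable, i.e. every $g\in\Gamma$ is the restriction to $\Lambda$ of some $g_\#\in \mathrm{O}^+(\Lambda_\#)$ with $g_\#(\Lambda)\subset\Lambda$. Consider the induced map $$\psi_\Gamma\colon \Omega(\Lambda)/\Gamma\longrightarrow\Omega(\Lambda_\#)/\mathrm{O}^+(\Lambda_\#).$$ Its degree onto its image is the number $d$ of points of its very general fibre: for all $x\in\Omega(\Lambda)$ outside of a countable union of proper closed analytic subsets, the fibre of $\psi_\Gamma$ through the class of $x$ has exactly $d$ points. Then this degree exists as a finite number, and it is less than or equal to $$[\widetilde{\mathrm{O}}^+(\Lambda):\Gamma\cap\widetilde{\mathrm{O}}^+(\Lambda)]\cdot[\widetilde{\mathrm{O}}^+(\Lambda_s):\widetilde{\mathrm{O}}^+(\Lambda)]\cdot|\mathrm{O}(D(\Lambda_s))|,$$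 where $\widetilde{\mathrm{O}}^+(\Lambda)$ is regarded as the subgroup of those elements of $\widetilde{\mathrm{O}}^+(\Lambda_s)$ which restrict to an element of $\widetilde{\mathrm{O}}^+(\Lambda)$ on $\Lambda$. -/

import Mathlib

open scoped TensorProduct LinearAlgebra.Projectivization

noncomputable section

/-- The structure of an even lattice on a (finitely generated free) abelian group `L`: a symmetric
integral bilinear form with `(x, x)` even for all `x`.  Nondegeneracy is part of `HasSignature`. -/
structure EvenLattice (L : Type*) [AddCommGroup L] where
  form : LinearMap.BilinForm ℤ L
  symm : ∀ x y, form x y = form y x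
  even : ∀ x, Even (form x x)

/-- The norm on `L ⊗ ℂ` coming from the coordinates in some `ℤ`-basis of `L`; it induces the usual
topology (and the usual notion of holomorphic function) of a finite dimensional complex vector
space. -/
instance complexificationNorm (L : Type*) [AddCommGroup L] [Module.Free ℤ L] [Module.Finite ℤ L] :
    NormedAddCommGroup (ℂ ⊗[ℤ] L) :=
  NormedAddCommGroup.induced _ _
    ((Module.Free.chooseBasis ℤ L).baseChange ℂ).equivFun
    ((Module.Free.chooseBasis ℤ L).baseChange ℂ).equivFun.injective

instance complexificationNormedSpace
    (L : Type*) [AddCommGroup L] [Module.Free ℤ L] [Module.Finite ℤ L] :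
    NormedSpace ℂ (ℂ ⊗[ℤ] L) :=
  NormedSpace.induced ℂ (ℂ ⊗[ℤ] L) _ ((Module.Free.chooseBasis ℤ L).baseChange ℂ).equivFun

/-- The quotient topology on a complex projective space. -/
instance projectivizationTopology (V : Type*) [AddCommGroup V] [Module ℂ V] [TopologicalSpace V] :
    TopologicalSpace (ℙ ℂ V) :=
  TopologicalSpace.coinduced (fun v : {v : V // v ≠ 0} => Projectivization.mk' ℂ v) inferInstance

/-- The complexification of an injective homomorphism of abelian groups is injective. -/
theorem baseChange_complex_injective {L L' : Type*} [AddCommGroup L] [AddCommGroup L']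
    (f : L →ₗ[ℤ] L') (hf : Function.Injective f) : Function.Injective (f.baseChange ℂ) :=
  Module.Flat.lTensor_preserves_injective_linearMap (M := ℂ) f hf

/-- The map `ℙ(L ⊗ ℂ) → ℙ(L' ⊗ ℂ)` induced by an injective homomorphism `L → L'`. -/
def projMap {L L' : Type*} [AddCommGroup L] [AddCommGroup L']
    (f : L →ₗ[ℤ] L') (hf : Function.Injective f) : ℙ ℂ (ℂ ⊗[ℤ] L) → ℙ ℂ (ℂ ⊗[ℤ] L') :=
  Projectivization.map (f.baseChange ℂ) (baseChange_complex_injective f hf)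

/-- The action of an automorphism of `L` on `ℙ(L ⊗ ℂ)`. -/
def projAct {L : Type*} [AddCommGroup L] (g : L ≃ₗ[ℤ] L) (x : ℙ ℂ (ℂ ⊗[ℤ] L)) :
    ℙ ℂ (ℂ ⊗[ℤ] L) :=
  projMap g.toLinearMap g.injective x

theorem projMap_comp {L L' L'' : Type*} [AddCommGroup L] [AddCommGroup L'] [AddCommGroup L'']
    (f : L →ₗ[ℤ] L') (hf : Function.Injective f) (g : L' →ₗ[ℤ] L'') (hg : Function.Injective g)
    (h : L →ₗ[ℤ] L'') (hh : Function.Injective h) (H : ∀ x, h x = g (f x))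
    (x : ℙ ℂ (ℂ ⊗[ℤ] L)) : projMap h hh x = projMap g hg (projMap f hf x) := by
  obtain rfl : h = g ∘ₗ f := LinearMap.ext H
  induction x using Projectivization.ind with
  | h v hv =>
    simp only [projMap, Projectivization.map_mk]
    congr 1
    rw [LinearMap.baseChange_comp]
    rfl

theorem projAct_one {L : Type*} [AddCommGroup L] (x : ℙ ℂ (ℂ ⊗[ℤ] L)) :
    projAct (1 : L ≃ₗ[ℤ] L) x = x := by
  induction x using Projectivization.ind with
  | h v hv =>
    simp only [projAct, projMap, Projectivization.map_mk]
    congr 1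
    change (LinearMap.id : L →ₗ[ℤ] L).baseChange ℂ v = v
    rw [LinearMap.baseChange_id]
    rfl

theorem projAct_mul {L : Type*} [AddCommGroup L] (g h : L ≃ₗ[ℤ] L) (x : ℙ ℂ (ℂ ⊗[ℤ] L)) :
    projAct (g * h) x = projAct g (projAct h x) :=
  projMap_comp _ _ _ _ _ _ (fun _ => rfl) x

/-- The extension of scalars of a homomorphism which preserves bilinear forms preserves the
extended forms. -/
theorem baseChange_form_map {A L L' : Type*} [CommRing A] [AddCommGroup L] [AddCommGroup L']
    (B : LinearMap.BilinForm ℤ L) (B' : LinearMap.BilinForm ℤ L') (f : L →ₗ[ℤ] L')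
    (hf : ∀ x y, B' (f x) (f y) = B x y) (x y : A ⊗[ℤ] L) :
    B'.baseChange A (f.baseChange A x) (f.baseChange A y) = B.baseChange A x y := by
  induction x using TensorProduct.induction_on with
  | zero => simp
  | add x₁ x₂ h₁ h₂ => simp only [map_add, LinearMap.add_apply, h₁, h₂]
  | tmul a u =>
    induction y using TensorProduct.induction_on with
    | zero => simp
    | add y₁ y₂ h₁ h₂ => simp only [map_add, h₁, h₂]
    | tmul b v => simp [LinearMap.BilinForm.baseChange_tmul, hf]

theorem baseChange_equiv_mul {A L : Type*} [CommRing A] [AddCommGroup L] (g h : L ≃ₗ[ℤ] L)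
    (x : A ⊗[ℤ] L) :
    (g * h).toLinearMap.baseChange A x =
      g.toLinearMap.baseChange A (h.toLinearMap.baseChange A x) := by
  change (g.toLinearMap ∘ₗ h.toLinearMap).baseChange A x = _
  rw [LinearMap.baseChange_comp]
  rfl

theorem baseChange_equiv_one {A L : Type*} [CommRing A] [AddCommGroup L] (x : A ⊗[ℤ] L) :
    (1 : L ≃ₗ[ℤ] L).toLinearMap.baseChange A x = x := by
  change (LinearMap.id : L →ₗ[ℤ] L).baseChange A x = x
  rw [LinearMap.baseChange_id]
  rfl

namespace EvenLattice

variable {L : Type*} [AddCommGroup L] (Λ : EvenLattice L)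

/-- `Λ` is nondegenerate of signature `(p, q)`: the real quadratic form `(x, x)` on `Λ ⊗ ℝ` has
positive index `p`, negative index `q`, and `p + q` is the rank of `Λ`. -/
def HasSignature (p q : ℕ) : Prop :=
  sigPos (Λ.form.baseChange ℝ).toQuadraticMap = p ∧
  sigNeg (Λ.form.baseChange ℝ).toQuadraticMap = q ∧
  Module.finrank ℤ L = p + q

/-- The lattice structure induced on a subgroup. -/
def restrict (S : Submodule ℤ L) : EvenLattice S where
  form := Λ.form.restrict S
  symm x y := Λ.symm x y
  even x := Λ.even x

/-! ### Isometry groups -/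

/-- The group `O(Λ)` of isometries of `Λ`. -/
def orthogonalGroup : Subgroup (L ≃ₗ[ℤ] L) where
  carrier := {g | ∀ x y, Λ.form (g x) (g y) = Λ.form x y}
  mul_mem' {g h} hg hh x y := (hg (h x) (h y)).trans (hh x y)
  one_mem' _ _ := rfl
  inv_mem' {g} hg x y := by
    have h := hg (g⁻¹ x) (g⁻¹ y)
    rw [show g (g⁻¹ x) = x from g.apply_symm_apply x,
      show g (g⁻¹ y) = y from g.apply_symm_apply y] at h
    exact h.symm

/-- `p 0, p 1` is a basis of a positive definite real `2`-plane in `Λ ⊗ ℝ`. -/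
def IsPositiveFrame (p : Fin 2 → ℝ ⊗[ℤ] L) : Prop :=
  (Matrix.of fun i j => Λ.form.baseChange ℝ (p i) (p j)).PosDef

/-- The frames `p` and `q` of positive `2`-planes `P` and `Q` define the same orientation: the
orthogonal projection `Q → P` carries `q` to a frame of `P` oriented in the same way as `p`
(its matrix is the inverse Gram matrix of `p` times the matrix of the products `(p i, q j)`). -/
def SameOrientation (p q : Fin 2 → ℝ ⊗[ℤ] L) : Prop :=
  0 < (Matrix.of fun i j => Λ.form.baseChange ℝ (p i) (q j)).det

theorem IsPositiveFrame.map {p : Fin 2 → ℝ ⊗[ℤ] L} (hp : Λ.IsPositiveFrame p) {g : L ≃ₗ[ℤ] L}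
    (hg : g ∈ Λ.orthogonalGroup) :
    Λ.IsPositiveFrame (fun i => g.toLinearMap.baseChange ℝ (p i)) := by
  unfold IsPositiveFrame at hp ⊢
  simpa only [baseChange_form_map Λ.form Λ.form g.toLinearMap hg] using hp

/-- The group `O⁺(Λ)` of the isometries which preserve the orientation of the positive `2`-planes
in `Λ ⊗ ℝ`, that is, such that `q` and `g q` are equally oriented for all positive frames `q`. -/
def orthogonalGroupPlus : Subgroup (L ≃ₗ[ℤ] L) where
  carrier := {g | g ∈ Λ.orthogonalGroup ∧ ∀ p q, Λ.IsPositiveFrame p → Λ.IsPositiveFrame q →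
    (Λ.SameOrientation p q ↔
      Λ.SameOrientation p (fun i => g.toLinearMap.baseChange ℝ (q i)))}
  mul_mem' {g h} hg hh := by
    refine ⟨mul_mem hg.1 hh.1, fun p q hp hq => ?_⟩
    simp only [baseChange_equiv_mul]
    exact (hh.2 p q hp hq).trans (hg.2 p _ hp (IsPositiveFrame.map Λ hq hh.1))
  one_mem' := by
    refine ⟨one_mem _, fun p q _ _ => ?_⟩
    simp only [baseChange_equiv_one]
  inv_mem' {g} hg := by
    refine ⟨inv_mem hg.1, fun p q hp hq => ?_⟩
    have h := hg.2 p _ hp (IsPositiveFrame.map Λ hq (inv_mem hg.1))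
    simp only [← baseChange_equiv_mul, mul_inv_cancel, baseChange_equiv_one] at h
    exact h.symm

/-! ### The discriminant group -/

/-- The image of `L` in `L ⊗ ℚ`. -/
def rationalImage (L : Type*) [AddCommGroup L] : Submodule ℤ (ℚ ⊗[ℤ] L) :=
  LinearMap.range (TensorProduct.mk ℤ ℚ L 1)

/-- The dual lattice `Λ^∨ = {v ∈ Λ ⊗ ℚ | (v, Λ) ⊆ ℤ}`. -/
def dual : Submodule ℤ (ℚ ⊗[ℤ] L) :=
  (Λ.form.baseChange ℚ).dualSubmodule (rationalImage L)

/-- The discriminant group `D(Λ) = Λ^∨ / Λ`. -/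
abbrev Disc : Type _ := Λ.dual ⧸ (rationalImage L).submoduleOf Λ.dual

theorem rational_form_symm (x y : ℚ ⊗[ℤ] L) :
    Λ.form.baseChange ℚ x y = Λ.form.baseChange ℚ y x := by
  induction x using TensorProduct.induction_on with
  | zero => simp
  | add x₁ x₂ h₁ h₂ => simp only [map_add, LinearMap.add_apply, h₁, h₂]
  | tmul a u =>
    induction y using TensorProduct.induction_on with
    | zero => simp
    | add y₁ y₂ h₁ h₂ => simp only [map_add, LinearMap.add_apply, h₁, h₂]
    | tmul b v =>
      simp only [LinearMap.BilinForm.baseChange_tmul]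
      rw [Λ.symm u v, mul_comm a b]

/-- The discriminant quadratic form `D(Λ) → ℚ / 2ℤ`, `[x] ↦ (x, x) mod 2ℤ`. -/
def discForm (d : Λ.Disc) : AddCircle (2 : ℚ) :=
  Quotient.liftOn' d
    (fun x => ((Λ.form.baseChange ℚ (x : ℚ ⊗[ℤ] L) (x : ℚ ⊗[ℤ] L) : ℚ) : AddCircle (2 : ℚ)))
    (by
      intro x y h
      rw [Submodule.quotientRel_def] at h
      obtain ⟨l, hl⟩ := h
      have hl' : (1 : ℚ) ⊗ₜ[ℤ] l = (x : ℚ ⊗[ℤ] L) - y := hl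
      obtain ⟨n, hn⟩ := Submodule.mem_one.mp (y.2 _ ⟨l, rfl⟩)
      have hn' : (n : ℚ) = Λ.form.baseChange ℚ (y : ℚ ⊗[ℤ] L) ((1 : ℚ) ⊗ₜ[ℤ] l) := by
        rw [algebraMap_int_eq, eq_intCast] at hn
        exact hn
      obtain ⟨k, hk⟩ := Λ.even l
      have hx : (x : ℚ ⊗[ℤ] L) = y + (1 : ℚ) ⊗ₜ[ℤ] l := by rw [hl']; abel
      rw [QuotientAddGroup.eq, AddSubgroup.mem_zmultiples_iff]
      refine ⟨-(n + k), ?_⟩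
      rw [hx]
      simp only [map_add, LinearMap.add_apply]
      rw [Λ.rational_form_symm ((1 : ℚ) ⊗ₜ[ℤ] l) y, ← hn',
        LinearMap.BilinForm.baseChange_tmul, hk]
      simp only [zsmul_eq_mul]
      push_cast
      ring)

/-- The group `O(D(Λ))` of automorphisms of `D(Λ)` preserving the discriminant form. -/
def discOrthogonalGroup : Subgroup (Λ.Disc ≃ₗ[ℤ] Λ.Disc) where
  carrier := {g | ∀ d, Λ.discForm (g d) = Λ.discForm d}
  mul_mem' {g h} hg hh d := (hg (h d)).trans (hh d)
  one_mem' _ := rfl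
  inv_mem' {g} hg d := by
    have h := hg (g⁻¹ d)
    rw [show g (g⁻¹ d) = d from g.apply_symm_apply d] at h
    exact h.symm

theorem baseChange_mem_rationalImage (g : L ≃ₗ[ℤ] L) {x : ℚ ⊗[ℤ] L}
    (hx : x ∈ rationalImage L) : g.toLinearMap.baseChange ℚ x ∈ rationalImage L := by
  obtain ⟨l, rfl⟩ := hx
  exact ⟨g l, rfl⟩

/-- The stable orthogonal group `Õ(Λ)` of isometries which act trivially on `D(Λ)`. -/
def stableOrthogonalGroup : Subgroup (L ≃ₗ[ℤ] L) where
  carrier := {g | g ∈ Λ.orthogonalGroup ∧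
    ∀ x ∈ Λ.dual, g.toLinearMap.baseChange ℚ x - x ∈ rationalImage L}
  mul_mem' {g h} hg hh := by
    refine ⟨mul_mem hg.1 hh.1, fun x hx => ?_⟩
    have h1 := add_mem (baseChange_mem_rationalImage g (hh.2 x hx)) (hg.2 x hx)
    rw [map_sub, sub_add_sub_cancel] at h1
    rwa [baseChange_equiv_mul]
  one_mem' := by
    refine ⟨one_mem _, fun x _ => ?_⟩
    rw [baseChange_equiv_one, sub_self]
    exact zero_mem _
  inv_mem' {g} hg := by
    refine ⟨inv_mem hg.1, fun x hx => ?_⟩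
    have h1 := neg_mem (baseChange_mem_rationalImage g⁻¹ (hg.2 x hx))
    rwa [map_sub, ← baseChange_equiv_mul, inv_mul_cancel, baseChange_equiv_one, neg_sub] at h1

/-- `Õ⁺(Λ) = O⁺(Λ) ∩ Õ(Λ)`. -/
def stableOrthogonalGroupPlus : Subgroup (L ≃ₗ[ℤ] L) :=
  Λ.orthogonalGroupPlus ⊓ Λ.stableOrthogonalGroup

/-! ### Period domains and period spaces -/

/-- Complex conjugation on `L ⊗ ℂ`. -/
def complexConj (L : Type*) [AddCommGroup L] : ℂ ⊗[ℤ] L →ₗ[ℤ] ℂ ⊗[ℤ] L :=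
  LinearMap.rTensor L (starRingEnd ℂ).toAddMonoidHom.toIntLinearMap

/-- The set of `[w] ∈ ℙ(Λ ⊗ ℂ)` with `(w, w) = 0` and `(w, w̄) > 0`. -/
def periodSet : Set (ℙ ℂ (ℂ ⊗[ℤ] L)) :=
  {x | ∃ (w : ℂ ⊗[ℤ] L) (hw : w ≠ 0), x = Projectivization.mk ℂ w hw ∧
    Λ.form.baseChange ℂ w w = 0 ∧ 0 < (Λ.form.baseChange ℂ w (complexConj L w)).re}

/-- `Ω` is one of the connected components of `periodSet`, i.e. a period domain `Ω(Λ)`. -/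
def IsPeriodDomain [Module.Free ℤ L] [Module.Finite ℤ L] (Ω : Set (ℙ ℂ (ℂ ⊗[ℤ] L))) : Prop :=
  ∃ x ∈ Λ.periodSet, Ω = connectedComponentIn Λ.periodSet x

end EvenLattice

/-- The relation `x ∼ y ↔ ∃ g ∈ Γ, g x = y` on a set `Ω` of points of `ℙ(L ⊗ ℂ)`. -/
def periodSetoid {L : Type*} [AddCommGroup L] (Ω : Set (ℙ ℂ (ℂ ⊗[ℤ] L)))
    (Γ : Subgroup (L ≃ₗ[ℤ] L)) : Setoid Ω where
  r x y := ∃ g ∈ Γ, projAct g x = (y : ℙ ℂ (ℂ ⊗[ℤ] L))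
  iseqv :=
    { refl := fun x => ⟨1, one_mem Γ, projAct_one _⟩
      symm := fun {x y} ⟨g, hg, h⟩ => ⟨g⁻¹, inv_mem hg, by
        rw [← h, ← projAct_mul, inv_mul_cancel, projAct_one]⟩
      trans := fun {x y z} ⟨g, hg, h⟩ ⟨g', hg', h'⟩ => ⟨g' * g, mul_mem hg' hg, by
        rw [projAct_mul, h, h']⟩ }

/-- The period space `Ω / Γ`. -/
abbrev PeriodSpace {L : Type*} [AddCommGroup L] (Ω : Set (ℙ ℂ (ℂ ⊗[ℤ] L)))
    (Γ : Subgroup (L ≃ₗ[ℤ] L)) : Type _ :=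
  Quotient (periodSetoid Ω Γ)

/-- `A` is a closed analytic subset of the (quadric) complex manifold `Ω ⊆ ℙ(L ⊗ ℂ)`: near every
point of the cone over `Ω`, the cone over `A` is the set of common zeros on the cone over `Ω` of a
family of holomorphic functions. -/
def IsAnalyticSubset {L : Type*} [AddCommGroup L] [Module.Free ℤ L] [Module.Finite ℤ L]
    (Ω A : Set (ℙ ℂ (ℂ ⊗[ℤ] L))) : Prop :=
  A ⊆ Ω ∧ ∀ (v : ℂ ⊗[ℤ] L) (hv : v ≠ 0), Projectivization.mk ℂ v hv ∈ Ω →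
    ∃ U : Set (ℂ ⊗[ℤ] L), IsOpen U ∧ v ∈ U ∧
      ∃ 𝓕 : Set (ℂ ⊗[ℤ] L → ℂ), (∀ F ∈ 𝓕, DifferentiableOn ℂ F U) ∧
        ∀ u ∈ U, ∀ hu : u ≠ 0, Projectivization.mk ℂ u hu ∈ Ω →
          (Projectivization.mk ℂ u hu ∈ A ↔ ∀ F ∈ 𝓕, F u = 0)

/-- `d` is the degree onto its image of the (generically finite) map `ψ` from `Ω / Γ`: for a very
general point `x` of `Ω`, i.e. for all `x` outside of a countable union of proper closed analytic
subsets of `Ω`, the fibre of `ψ` through the class of `x` has exactly `d` points. -/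
def HasDegreeOntoImage {L : Type*} [AddCommGroup L] [Module.Free ℤ L] [Module.Finite ℤ L]
    {Ω : Set (ℙ ℂ (ℂ ⊗[ℤ] L))} {Γ : Subgroup (L ≃ₗ[ℤ] L)} {Y : Type*}
    (ψ : PeriodSpace Ω Γ → Y) (d : ℕ) : Prop :=
  ∃ A : ℕ → Set (ℙ ℂ (ℂ ⊗[ℤ] L)), (∀ n, IsAnalyticSubset Ω (A n) ∧ A n ≠ Ω) ∧
    ∀ x : Ω, (∀ n, (x : ℙ ℂ (ℂ ⊗[ℤ] L)) ∉ A n) →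
      (ψ ⁻¹' {ψ (Quotient.mk (periodSetoid Ω Γ) x)}).encard = d

/-! ### Embeddings of lattices -/

/-- An embedding of lattices `Λ ↪ Λ'`, not necessarily primitive. -/
structure LatticeEmbedding {L L' : Type*} [AddCommGroup L] [AddCommGroup L']
    (Λ : EvenLattice L) (Λ' : EvenLattice L') where
  toLinearMap : L →ₗ[ℤ] L'
  injective : Function.Injective toLinearMap
  map_form : ∀ x y, Λ'.form (toLinearMap x) (toLinearMap y) = Λ.form x y

namespace LatticeEmbedding

variable {L L' : Type*} [AddCommGroup L] [AddCommGroup L']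
  {Λ : EvenLattice L} {Λ' : EvenLattice L'} (ι : LatticeEmbedding Λ Λ')

/-- The group of automorphisms of `L'` which restrict along `ι` to an element of `H`. For `H` a
group whose elements extend uniquely to `L'`, this is `H` as a group of automorphisms of `L'`. -/
def extensions (H : Subgroup (L ≃ₗ[ℤ] L)) : Subgroup (L' ≃ₗ[ℤ] L') where
  carrier := {g' | ∃ g ∈ H, ∀ x, g' (ι.toLinearMap x) = ι.toLinearMap (g x)}
  mul_mem' := by
    rintro g' h' ⟨g, hg, hgg⟩ ⟨h, hh, hhh⟩
    refine ⟨g * h, mul_mem hg hh, fun x => ?_⟩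
    change g' (h' (ι.toLinearMap x)) = ι.toLinearMap (g (h x))
    rw [hhh, hgg]
  one_mem' := ⟨1, one_mem H, fun _ => rfl⟩
  inv_mem' := by
    rintro g' ⟨g, hg, hgg⟩
    refine ⟨g⁻¹, inv_mem hg, fun x => ?_⟩
    apply g'.injective
    rw [hgg, show g (g⁻¹ x) = x from g.apply_symm_apply x]
    exact g'.apply_symm_apply _

/-- `Γ` is extendable with respect to `ι`: each `g ∈ Γ` is the restriction to `Λ` of some
`g' ∈ O⁺(Λ')` (which, in particular, maps `Λ` into itself). -/
def IsExtendable (Γ : Subgroup (L ≃ₗ[ℤ] L)) : Prop :=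
  ∀ g ∈ Γ, ∃ g' ∈ Λ'.orthogonalGroupPlus, ∀ x, g' (ι.toLinearMap x) = ι.toLinearMap (g x)

/-- The saturation of `Λ` in `Λ'`, as a subgroup of `L'`. -/
def saturation : Submodule ℤ L' where
  carrier := {y | ∃ n : ℤ, n ≠ 0 ∧ ∃ x, ι.toLinearMap x = n • y}
  zero_mem' := ⟨1, one_ne_zero, 0, by simp⟩
  add_mem' := by
    rintro y z ⟨n, hn, x, hx⟩ ⟨m, hm, w, hw⟩
    refine ⟨n * m, mul_ne_zero hn hm, m • x + n • w, ?_⟩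
    rw [map_add, map_smul, map_smul, hx, hw, smul_add, smul_smul, smul_smul, mul_comm m n]
  smul_mem' := by
    rintro c y ⟨n, hn, x, hx⟩
    refine ⟨n, hn, c • x, ?_⟩
    rw [map_smul, hx, smul_comm]

/-- The saturation `Λ_s` of `Λ` in `Λ'`, as a lattice. -/
def saturationLattice : EvenLattice ι.saturation := Λ'.restrict ι.saturation

/-- The embedding `Λ ↪ Λ_s`. -/
def toSaturation : LatticeEmbedding Λ ι.saturationLattice where
  toLinearMap := ι.toLinearMap.codRestrict ι.saturation
    (fun x => ⟨1, one_ne_zero, x, (one_smul ℤ _).symm⟩)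
  injective _ _ h := ι.injective (congrArg Subtype.val h)
  map_form x y := ι.map_form x y

/-- The map `ℙ(Λ ⊗ ℂ) → ℙ(Λ' ⊗ ℂ)` induced by `ι`. -/
def onPeriods : ℙ ℂ (ℂ ⊗[ℤ] L) → ℙ ℂ (ℂ ⊗[ℤ] L') := projMap ι.toLinearMap ι.injective

/-- The map `ψ_Γ : Ω(Λ) / Γ → Ω(Λ') / O⁺(Λ')` induced by an embedding `Λ ↪ Λ'`, for `Γ`
extendable; the component `Ω' = Ω(Λ')` is the one which contains the image of `Ω = Ω(Λ)`. -/
def periodMap {Γ : Subgroup (L ≃ₗ[ℤ] L)} (hΓ : ι.IsExtendable Γ)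
    {Ω : Set (ℙ ℂ (ℂ ⊗[ℤ] L))} {Ω' : Set (ℙ ℂ (ℂ ⊗[ℤ] L'))}
    (hΩ : Set.MapsTo ι.onPeriods Ω Ω') :
    PeriodSpace Ω Γ → PeriodSpace Ω' Λ'.orthogonalGroupPlus :=
  Quotient.map (sa := periodSetoid Ω Γ) (sb := periodSetoid Ω' Λ'.orthogonalGroupPlus)
    (fun x => ⟨ι.onPeriods x, hΩ x.2⟩) (by
      intro x y h0
      obtain ⟨g, hg, h⟩ := h0
      obtain ⟨g', hg', hgg⟩ := hΓ g hg
      refine ⟨g', hg', ?_⟩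
      change projMap g'.toLinearMap g'.injective (projMap ι.toLinearMap ι.injective x) =
        projMap ι.toLinearMap ι.injective y
      rw [← h]
      have hc : Function.Injective (g'.toLinearMap ∘ₗ ι.toLinearMap) :=
        g'.injective.comp ι.injective
      rw [← projMap_comp ι.toLinearMap ι.injective g'.toLinearMap g'.injective _ hc
        (fun _ => rfl)]
      exact projMap_comp g.toLinearMap g.injective ι.toLinearMap ι.injective _ hc hgg x)

end LatticeEmbedding

end

/-! Write `Γ_s` for the group of automorphisms of the saturation `Λ_s` that restrict to elements of
`Γ`. The degree is at most the index of `Γ_s` in `O⁺(Λ_s)`, and this index is at most the stated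
product.

Geometry. Call a point `x` of `Ω` very general if it lies on no rational hyperplane and every
automorphism of `L'` fixing `ι(x)` fixes `ι(Ω)` pointwise. Integral data are countable, so this
excludes only countably many proper analytic subsets (`exists_analyticSubsets`). If `g ∈ O⁺(Λ')`
maps such an `ι(x)` to `ι(y)` with `y ∈ Ω`, then `g` preserves `Λ_s`, because no proper rational
subspace of `Λ ⊗ ℚ` contains `x` after complexification (`map_saturation_eq`), and `g` maps `ι(Ω)`
into itself by connectedness (`exists_onPeriods_eq`). So the fibre is the orbit of `x` under
`stabilizerSet`, taken modulo `Γ` (`fibre_eq_range`). Two elements give the same point exactly when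
they differ on `ι(Ω)` by an extension of an element of `Γ`. This condition does not involve `x`
(`orbitClass_eq_iff`), so all very general fibres have the same cardinality. Restriction to `Λ_s`
embeds the set of classes into `O⁺(Λ_s) / Γ_s` (`finite_quot_orbitRel_and_card_le`).

Arithmetic. The index is estimated along `Γ_s`, `Õ⁺(Λ)_s`, `Õ⁺(Λ_s)`, `O⁺(Λ_s)`. The first step is
controlled by restriction to `Λ`, the second is finite by a congruence argument, and the third is at
most `|O(D(Λ_s))|`, since `Õ⁺` is the kernel of the action on the discriminant group. -/

noncomputable section

/-! ### Relative indices -/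

/-- If the fibres of a map from `K` to a finite set are contained in left cosets of `H`, then `H` has
finite relative index in `K`, at most the cardinality of the set. -/
theorem relIndex_ne_zero_and_le_card {G X : Type*} [Group G] [Finite X] {H K : Subgroup G}
    (φ : K → X) (hφ : ∀ g h : K, φ g = φ h → (g : G)⁻¹ * h ∈ H) :
    H.relIndex K ≠ 0 ∧ H.relIndex K ≤ Nat.card X := by
  have hinj : Function.Injective fun q : K ⧸ H.subgroupOf K => φ q.out := by
    intro q q' h
    rw [← q.out_eq', ← q'.out_eq']
    exact QuotientGroup.eq.mpr (hφ _ _ h)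
  have : Finite (K ⧸ H.subgroupOf K) := Finite.of_injective _ hinj
  exact ⟨Nat.card_pos.ne', Nat.card_le_card_of_injective _ hinj⟩

/-- The four groups need not be nested. Intersecting the smaller group with the next one can only
raise a finite index, and shrinking the ambient group can only lower it, so multiplicativity
survives as an inequality. Nonvanishing is carried along because an infinite index has value `0`. -/
theorem relIndex_ne_zero_and_le_mul {G : Type*} [Group G] {C B A O : Subgroup G}
    (hCB : C.relIndex B ≠ 0) (hBA : B.relIndex A ≠ 0) (hAO : A.relIndex O ≠ 0) :
    C.relIndex O ≠ 0 ∧ C.relIndex O ≤ C.relIndex B * B.relIndex A * A.relIndex O := by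
  have hne := Subgroup.relIndex_ne_zero_trans (Subgroup.relIndex_ne_zero_trans hCB hBA) hAO
  refine ⟨hne, ?_⟩
  have h1 : C.relIndex A ≤ C.relIndex B * B.relIndex A := by
    have h0 : C.relIndex A ≠ 0 := Subgroup.relIndex_ne_zero_trans hCB hBA
    calc C.relIndex A ≤ (C ⊓ B).relIndex A :=
          Subgroup.relIndex_le_of_le_left inf_le_left (Subgroup.relIndex_inf_ne_zero h0 hBA)
      _ = C.relIndex (B ⊓ A) * B.relIndex A := (Subgroup.relIndex_inf_mul_relIndex _ _ _).symm
      _ ≤ _ := Nat.mul_le_mul_right _ (Subgroup.relIndex_le_of_le_right inf_le_left hCB)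
  calc C.relIndex O ≤ (C ⊓ A).relIndex O :=
        Subgroup.relIndex_le_of_le_left inf_le_left (Subgroup.relIndex_inf_ne_zero hne hAO)
    _ = C.relIndex (A ⊓ O) * A.relIndex O := (Subgroup.relIndex_inf_mul_relIndex _ _ _).symm
    _ ≤ C.relIndex A * A.relIndex O := Nat.mul_le_mul_right _
        (Subgroup.relIndex_le_of_le_right inf_le_left (Subgroup.relIndex_ne_zero_trans hCB hBA))
    _ ≤ _ := Nat.mul_le_mul_right _ h1

/-! ### Finitely generated abelian groups -/

theorem finite_quotient_of_torsion {M : Type*} [AddCommGroup M] [Module.Finite ℤ M]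
    (P : Submodule ℤ M) (h : ∀ m, ∃ n : ℤ, n ≠ 0 ∧ n • m ∈ P) : Finite (M ⧸ P) := by
  apply Module.finite_of_fg_torsion
  intro q
  obtain ⟨m, rfl⟩ := P.mkQ_surjective q
  obtain ⟨n, hn, hm⟩ := h m
  refine ⟨⟨n, mem_nonZeroDivisors_of_ne_zero hn⟩, ?_⟩
  change n • P.mkQ m = 0
  rw [← map_smul]
  exact (Submodule.Quotient.mk_eq_zero P).mpr hm

theorem exists_smul_mem_of_torsion {M : Type*} [AddCommGroup M] [Module.Finite ℤ M]
    (P : Submodule ℤ M) (h : ∀ m, ∃ n : ℤ, n ≠ 0 ∧ n • m ∈ P) :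
    ∃ N : ℤ, N ≠ 0 ∧ ∀ m, N • m ∈ P := by
  have := finite_quotient_of_torsion P h
  refine ⟨Nat.card (M ⧸ P), Nat.cast_ne_zero.mpr Nat.card_pos.ne', fun m => ?_⟩
  rw [← Submodule.Quotient.mk_eq_zero, natCast_zsmul, Submodule.Quotient.mk_smul]
  exact card_nsmul_eq_zero'

theorem exists_smul_eq_one_tmul {L : Type*} [AddCommGroup L] (x : ℚ ⊗[ℤ] L) :
    ∃ n : ℤ, n ≠ 0 ∧ ∃ l : L, n • x = 1 ⊗ₜ l := by
  induction x using TensorProduct.induction_on with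
  | zero => exact ⟨1, one_ne_zero, 0, by simp⟩
  | tmul a l =>
    refine ⟨a.den, Nat.cast_ne_zero.mpr a.den_nz, a.num • l, ?_⟩
    rw [TensorProduct.smul_tmul', TensorProduct.tmul_smul, TensorProduct.smul_tmul']
    congr 1
    simp [Rat.den_mul_eq_num]
  | add x y hx hy =>
    obtain ⟨n, hn, l, hl⟩ := hx
    obtain ⟨k, hk, l', hl'⟩ := hy
    refine ⟨n * k, mul_ne_zero hn hk, k • l + n • l', ?_⟩
    rw [smul_add, TensorProduct.tmul_add, TensorProduct.tmul_smul, TensorProduct.tmul_smul, ← hl,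
      ← hl', smul_smul, smul_smul, mul_comm k n]


theorem one_tmul_injective {A L : Type*} [CommRing A] [CharZero A] [AddCommGroup L]
    [Module.Free ℤ L] : Function.Injective fun l : L => (1 : A) ⊗ₜ[ℤ] l := by
  intro x y h
  have h2 := @Module.Flat.rTensor_preserves_injective_linearMap _ _ (M := L) _ _ _ _ _ _ _ _ _
    (Algebra.linearMap ℤ A) (RingHom.injective_int (algebraMap ℤ A)) (1 ⊗ₜ x) (1 ⊗ₜ y)
    (by simpa using h)
  simpa using congrArg (TensorProduct.lid ℤ L) h2

theorem zsmul_left_cancel_of_rat {V : Type*} [AddCommGroup V] [Module ℚ V] {n : ℤ} (hn : n ≠ 0)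
    {x y : V} (h : n • x = n • y) : x = y := by
  rw [← Int.cast_smul_eq_zsmul ℚ, ← Int.cast_smul_eq_zsmul ℚ] at h
  exact smul_right_injective V (Int.cast_ne_zero.mpr hn) h


namespace EvenLattice

variable {L : Type*} [AddCommGroup L] {Λ : EvenLattice L}

/-! ### Finiteness of the discriminant group -/

/-- The two indices and the dimension of the radical add up to the rank, so the real radical
vanishes. It contains `1 ⊗ x`. -/
theorem HasSignature.eq_zero_of_form_eq_zero [Module.Free ℤ L] [Module.Finite ℤ L] {p q : ℕ} (h : Λ.HasSignature p q) (x : L)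
    (hx : ∀ y, Λ.form x y = 0) : x = 0 := by
  obtain ⟨hp, hq, hr⟩ := h
  have hrad := QuadraticForm.sigPos_add_sigNeg_add_radical
    (Q := (Λ.form.baseChange ℝ).toQuadraticMap)
  rw [hp, hq, Module.finrank_baseChange, hr, Nat.add_eq_left] at hrad
  have hbot := Submodule.finrank_eq_zero.mp hrad
  have hz : ∀ z : ℝ ⊗[ℤ] L, Λ.form.baseChange ℝ (1 ⊗ₜ x) z = 0 ∧
      Λ.form.baseChange ℝ z (1 ⊗ₜ x) = 0 := by
    intro z
    induction z using TensorProduct.induction_on with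
    | zero => simp
    | add z₁ z₂ h₁ h₂ => simp [h₁, h₂]
    | tmul a y => simp [LinearMap.BilinForm.baseChange_tmul, hx, Λ.symm y x]
  have hmem : (1 : ℝ) ⊗ₜ[ℤ] x ∈ (Λ.form.baseChange ℝ).toQuadraticMap.radical := by
    rw [QuadraticMap.mem_radical_iff']
    refine ⟨(hz _).1, fun z => ?_⟩
    simp [LinearMap.BilinMap.toQuadraticMap_apply, hz]
  rw [hbot, Submodule.mem_bot] at hmem
  exact one_tmul_injective (A := ℝ) (by simpa using hmem)

theorem rational_form_nondegenerate (hΛ : ∀ x, (∀ y, Λ.form x y = 0) → x = 0) :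
    (Λ.form.baseChange ℚ).Nondegenerate := by
  have key : ∀ x, (∀ y, Λ.form.baseChange ℚ x y = 0) → x = 0 := by
    intro x hx
    obtain ⟨n, hn, l, hl⟩ := exists_smul_eq_one_tmul x
    have hl0 : l = 0 := by
      refine hΛ l fun y => ?_
      have h := hx (1 ⊗ₜ y)
      have h2 : Λ.form.baseChange ℚ (n • x) (1 ⊗ₜ y) = 0 := by
        rw [map_zsmul, LinearMap.smul_apply, h, smul_zero]
      rw [hl, LinearMap.BilinForm.baseChange_tmul] at h2
      simpa using h2
    refine zsmul_left_cancel_of_rat hn ?_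
    rw [hl, hl0, TensorProduct.tmul_zero, smul_zero]
  exact ⟨key, fun y hy => key y fun x => (Λ.rational_form_symm y x).trans (hy x)⟩

/-- By nondegeneracy, the dual lattice is spanned by the dual basis of an integral basis. -/
theorem dual_finite [Module.Free ℤ L] [Module.Finite ℤ L]
    (hΛ : ∀ x, (∀ y, Λ.form x y = 0) → x = 0) : Module.Finite ℤ Λ.dual := by
  classical
  let b := (Module.Free.chooseBasis ℤ L).baseChange ℚ
  have hb : rationalImage L = Submodule.span ℤ (Set.range b) := by
    apply le_antisymm
    · rintro _ ⟨l, rfl⟩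
      change (1 : ℚ) ⊗ₜ[ℤ] l ∈ _
      rw [← (Module.Free.chooseBasis ℤ L).sum_repr l, TensorProduct.tmul_sum]
      refine sum_mem fun i _ => ?_
      rw [TensorProduct.tmul_smul]
      have hi : (1 : ℚ) ⊗ₜ[ℤ] Module.Free.chooseBasis ℤ L i = b i := by
        simp [b, Module.Basis.baseChange_apply]
      rw [hi]
      exact zsmul_mem (Submodule.subset_span (Set.mem_range_self i)) _
    · rw [Submodule.span_le]
      rintro _ ⟨i, rfl⟩
      exact ⟨Module.Free.chooseBasis ℤ L i, (Module.Basis.baseChange_apply _ _ i).symm⟩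
  have hd := (Λ.form.baseChange ℚ).dualSubmodule_span_of_basis (R := ℤ)
    (rational_form_nondegenerate hΛ) b
  unfold dual
  rw [hb]
  exact hd ▸ Module.Finite.span_of_finite ℤ (Set.finite_range _)

theorem dual_torsion (x : Λ.dual) :
    ∃ n : ℤ, n ≠ 0 ∧ n • x ∈ (rationalImage L).submoduleOf Λ.dual := by
  obtain ⟨n, hn, l, hl⟩ := exists_smul_eq_one_tmul (x : ℚ ⊗[ℤ] L)
  exact ⟨n, hn, l, hl.symm⟩

theorem disc_finite [Module.Free ℤ L] [Module.Finite ℤ L]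
    (hΛ : ∀ x, (∀ y, Λ.form x y = 0) → x = 0) : Finite Λ.Disc :=
  have := dual_finite hΛ
  finite_quotient_of_torsion _ dual_torsion

theorem exists_smul_dual_mem [Module.Free ℤ L] [Module.Finite ℤ L]
    (hΛ : ∀ x, (∀ y, Λ.form x y = 0) → x = 0) :
    ∃ N : ℤ, N ≠ 0 ∧ ∀ x ∈ Λ.dual, N • x ∈ rationalImage L := by
  have := dual_finite hΛ
  obtain ⟨N, hN, h⟩ := exists_smul_mem_of_torsion _ (dual_torsion (Λ := Λ))
  exact ⟨N, hN, fun x hx => h ⟨x, hx⟩⟩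

/-! ### The action on the discriminant group -/

theorem baseChange_mem_dual {g : L ≃ₗ[ℤ] L} (hg : g ∈ Λ.orthogonalGroup) {x : ℚ ⊗[ℤ] L}
    (hx : x ∈ Λ.dual) : g.toLinearMap.baseChange ℚ x ∈ Λ.dual := by
  rintro _ ⟨l, rfl⟩
  have h := hx _ ⟨g⁻¹ l, rfl⟩
  rw [← baseChange_form_map Λ.form Λ.form g.toLinearMap hg] at h
  convert h using 2
  change (1 : ℚ) ⊗ₜ[ℤ] l = (1 : ℚ) ⊗ₜ[ℤ] g (g⁻¹ l)
  congr 1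
  exact (g.apply_symm_apply l).symm

/-- The endomorphism of `D(Λ)` induced by an isometry of `Λ`. -/
def discMap (g : Λ.orthogonalGroup) : Λ.Disc →ₗ[ℤ] Λ.Disc :=
  Submodule.mapQ _ _
    (((g : L ≃ₗ[ℤ] L).toLinearMap.baseChange ℚ).toAddMonoidHom.toIntLinearMap.restrict
      fun _ hx => baseChange_mem_dual g.2 hx)
    fun _ hx => baseChange_mem_rationalImage (g : L ≃ₗ[ℤ] L) hx

theorem discMap_discMap_inv (g : Λ.orthogonalGroup) (d : Λ.Disc) :
    discMap g (discMap g⁻¹ d) = d := by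
  obtain ⟨x, rfl⟩ := Submodule.mkQ_surjective _ d
  refine congrArg (Submodule.mkQ _) (Subtype.ext ?_)
  change (g : L ≃ₗ[ℤ] L).toLinearMap.baseChange ℚ
    ((g⁻¹ : L ≃ₗ[ℤ] L).toLinearMap.baseChange ℚ (x : ℚ ⊗[ℤ] L)) = x
  rw [← baseChange_equiv_mul, mul_inv_cancel, baseChange_equiv_one]

/-- The isometry of `D(Λ)` induced by an isometry of `Λ`. -/
def discIsometry (g : Λ.orthogonalGroup) : Λ.discOrthogonalGroup :=
  ⟨LinearEquiv.ofLinearMap (discMap g) (discMap g⁻¹)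
    (LinearMap.ext (discMap_discMap_inv g))
    (LinearMap.ext fun d => by simpa using discMap_discMap_inv g⁻¹ d), fun d => by
      obtain ⟨x, rfl⟩ := Submodule.mkQ_surjective _ d
      exact congrArg (fun q : ℚ => (q : AddCircle (2 : ℚ)))
        (baseChange_form_map Λ.form Λ.form (g : L ≃ₗ[ℤ] L).toLinearMap g.2 _ _)⟩

/-- If `h x - g x` is integral for `x` in the dual, applying `g⁻¹` keeps it integral. -/
theorem inv_mul_mem_stableOrthogonalGroup {g h : Λ.orthogonalGroup}
    (H : discIsometry g = discIsometry h) :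
    (g : L ≃ₗ[ℤ] L)⁻¹ * h ∈ Λ.stableOrthogonalGroup := by
  refine ⟨mul_mem (inv_mem g.2) h.2, fun x hx => ?_⟩
  have h1 : discMap h (Submodule.mkQ _ ⟨x, hx⟩) = discMap g (Submodule.mkQ _ ⟨x, hx⟩) :=
    (LinearEquiv.congr_fun (congrArg Subtype.val H) (Submodule.mkQ _ ⟨x, hx⟩)).symm
  have h2 : (h : L ≃ₗ[ℤ] L).toLinearMap.baseChange ℚ x -
      (g : L ≃ₗ[ℤ] L).toLinearMap.baseChange ℚ x ∈ rationalImage L :=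
    (Submodule.Quotient.eq ((rationalImage L).submoduleOf Λ.dual)).mp h1
  have h3 := baseChange_mem_rationalImage (g : L ≃ₗ[ℤ] L)⁻¹ h2
  rwa [map_sub, ← baseChange_equiv_mul, ← baseChange_equiv_mul, inv_mul_cancel,
    baseChange_equiv_one] at h3

theorem stableOrthogonalGroupPlus_relIndex [Module.Free ℤ L] [Module.Finite ℤ L]
    (hΛ : ∀ x, (∀ y, Λ.form x y = 0) → x = 0) :
    Λ.stableOrthogonalGroupPlus.relIndex Λ.orthogonalGroupPlus ≠ 0 ∧
      Λ.stableOrthogonalGroupPlus.relIndex Λ.orthogonalGroupPlus ≤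
        Nat.card Λ.discOrthogonalGroup := by
  have := disc_finite hΛ
  have : Finite (Λ.Disc ≃ₗ[ℤ] Λ.Disc) := Finite.of_injective _ DFunLike.coe_injective
  refine relIndex_ne_zero_and_le_card (fun g => discIsometry ⟨g, g.2.1⟩) fun g h H => ?_
  exact ⟨Λ.orthogonalGroupPlus.mul_mem (inv_mem g.2) h.2, inv_mul_mem_stableOrthogonalGroup H⟩

/-! ### Restriction along an embedding -/

variable {L' : Type*} [AddCommGroup L'] {Λ' : EvenLattice L'}

/-- An isometry which is the restriction of an element of `O⁺(Λ')` is in `O⁺(Λ)`. -/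
theorem mem_orthogonalGroupPlus_of_extends (ι : LatticeEmbedding Λ Λ') {g' : L' ≃ₗ[ℤ] L'}
    (hg' : g' ∈ Λ'.orthogonalGroupPlus) {g : L ≃ₗ[ℤ] L}
    (h : ∀ x, g' (ι.toLinearMap x) = ι.toLinearMap (g x)) : g ∈ Λ.orthogonalGroupPlus := by
  have hR : ∀ x : ℝ ⊗[ℤ] L, ι.toLinearMap.baseChange ℝ (g.toLinearMap.baseChange ℝ x) =
      g'.toLinearMap.baseChange ℝ (ι.toLinearMap.baseChange ℝ x) := by
    intro x
    rw [← LinearMap.comp_apply, ← LinearMap.baseChange_comp, ← LinearMap.comp_apply,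
      ← LinearMap.baseChange_comp]
    congr 2
    exact LinearMap.ext fun x => (h x).symm
  -- Since `ι` preserves all Gram matrices, the orientation condition for `g` is that for `g'`,
  -- tested only on frames coming from `Λ`.
  have hframe : ∀ p, Λ.IsPositiveFrame p →
      Λ'.IsPositiveFrame fun i => ι.toLinearMap.baseChange ℝ (p i) := by
    intro p hp
    unfold IsPositiveFrame at hp ⊢
    simpa only [baseChange_form_map Λ.form Λ'.form ι.toLinearMap ι.map_form] using hp
  have hsame : ∀ p q, Λ.SameOrientation p q ↔
      Λ'.SameOrientation (fun i => ι.toLinearMap.baseChange ℝ (p i))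
        (fun i => ι.toLinearMap.baseChange ℝ (q i)) := by
    intro p q
    unfold SameOrientation
    simp only [baseChange_form_map Λ.form Λ'.form ι.toLinearMap ι.map_form]
  refine ⟨fun x y => ?_, fun p q hp hq => ?_⟩
  · rw [← ι.map_form, ← h, ← h, hg'.1, ι.map_form]
  · rw [hsame, hsame]
    simp only [hR]
    exact hg'.2 _ _ (hframe p hp) (hframe q hq)

end EvenLattice


/-! ### Index of `Γ` in the isometry group of the saturation -/

theorem exists_restriction {L L' : Type*} [AddCommGroup L] [AddCommGroup L'] {f : L →ₗ[ℤ] L'}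
    (hf : Function.Injective f) (k : L' ≃ₗ[ℤ] L')
    (hk : (LinearMap.range f).map k.toLinearMap = LinearMap.range f) :
    ∃ g : L ≃ₗ[ℤ] L, ∀ x, k (f x) = f (g x) := by
  let e := LinearEquiv.ofInjective f hf
  let k' := k.ofSubmodules _ _ hk
  refine ⟨e.trans (k'.trans e.symm), fun x => ?_⟩
  change _ = (e (e.symm (k' (e x))) : L')
  rw [e.apply_symm_apply]
  rfl

namespace LatticeEmbedding

open EvenLattice

variable {L L' : Type*} [AddCommGroup L] [AddCommGroup L']
  {Λ : EvenLattice L} {Λ' : EvenLattice L'} (ι : LatticeEmbedding Λ Λ')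

/-- Restriction to `L` sends cosets to cosets injectively. It need not be onto, as some elements of
`H` may not extend; hence only an inequality. -/
theorem extensions_relIndex_extensions {Γ H : Subgroup (L ≃ₗ[ℤ] L)} (hΓ : Γ.relIndex H ≠ 0) :
    (ι.extensions Γ).relIndex (ι.extensions H) ≠ 0 ∧
      (ι.extensions Γ).relIndex (ι.extensions H) ≤ Γ.relIndex H := by
  have : Finite (H ⧸ Γ.subgroupOf H) := Nat.finite_of_card_ne_zero hΓ
  choose r hr hrr using fun k : ι.extensions H => k.2
  refine relIndex_ne_zero_and_le_card
    (fun k => (QuotientGroup.mk ⟨r k, hr k⟩ : H ⧸ Γ.subgroupOf H)) fun g h H' => ?_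
  have hmem : (⟨r g, hr g⟩ : H)⁻¹ * ⟨r h, hr h⟩ ∈ Γ.subgroupOf H := QuotientGroup.eq.mp H'
  refine ⟨(r g)⁻¹ * r h, hmem, fun x => ?_⟩
  apply (g : L' ≃ₗ[ℤ] L').injective
  change (g : L' ≃ₗ[ℤ] L') ((g : L' ≃ₗ[ℤ] L').symm ((h : L' ≃ₗ[ℤ] L') (ι.toLinearMap x))) =
    (g : L' ≃ₗ[ℤ] L') (ι.toLinearMap ((r g).symm (r h x)))
  rw [LinearEquiv.apply_symm_apply, hrr, hrr, LinearEquiv.apply_symm_apply]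

/-- An isometry which is congruent to the identity modulo a suitable integer restricts to an
isometry acting trivially on the discriminant group. -/
theorem mem_extensions_of_congruent {N D : ℤ} (hN : ∀ y, ∃ x, ι.toLinearMap x = N • y)
    (hD0 : D ≠ 0) (hD : ∀ x ∈ Λ.dual, D • x ∈ rationalImage L) {k : L' ≃ₗ[ℤ] L'}
    (hk : k ∈ Λ'.orthogonalGroupPlus) (hkc : ∀ y, ∃ t, k y - y = (D * N) • t) :
    k ∈ ι.extensions Λ.stableOrthogonalGroupPlus := by
  -- The factor `N` brings the difference `k y - y` back into the image of `ι`; the factor `D` is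
  -- kept for the discriminant group.
  have hstep : ∀ x, ∃ x', k (ι.toLinearMap x) = ι.toLinearMap (x + D • x') := by
    intro x
    obtain ⟨t, ht⟩ := hkc (ι.toLinearMap x)
    obtain ⟨x', hx'⟩ := hN t
    refine ⟨x', ?_⟩
    rw [map_add, map_smul, hx', smul_smul, ← ht]
    abel
  have hmap : (LinearMap.range ι.toLinearMap).map k.toLinearMap =
      LinearMap.range ι.toLinearMap := by
    apply le_antisymm
    · rintro _ ⟨_, ⟨x, rfl⟩, rfl⟩
      obtain ⟨x', hx'⟩ := hstep x
      exact ⟨_, hx'.symm⟩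
    · rintro _ ⟨x, rfl⟩
      obtain ⟨t, ht⟩ := hkc (k.symm (ι.toLinearMap x))
      rw [k.apply_symm_apply] at ht
      obtain ⟨x', hx'⟩ := hN t
      refine ⟨k.symm (ι.toLinearMap x), ⟨x - D • x', ?_⟩, k.apply_symm_apply _⟩
      rw [map_sub, map_smul, hx', smul_smul, ← ht]
      abel
  obtain ⟨g, hg⟩ := exists_restriction ι.injective k hmap
  have hgp := mem_orthogonalGroupPlus_of_extends ι hk hg
  refine ⟨g, ⟨hgp, hgp.1, fun x hx => ?_⟩, hg⟩
  -- With `D x = l` integral and `g l = l + D x'`, division by `D` gives `g x - x = x'`, which is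
  -- integral.
  obtain ⟨l, hl⟩ := hD x hx
  obtain ⟨x', hx'⟩ := hstep l
  rw [hg] at hx'
  refine ⟨x', zsmul_left_cancel_of_rat hD0 ?_⟩
  have hl' : D • x = (1 : ℚ) ⊗ₜ[ℤ] l := hl.symm
  change D • ((1 : ℚ) ⊗ₜ[ℤ] x') = _
  rw [smul_sub, ← map_zsmul, hl', LinearMap.baseChange_tmul]
  change _ = (1 : ℚ) ⊗ₜ[ℤ] (g l) - _
  rw [ι.injective hx', TensorProduct.tmul_add, add_sub_cancel_left, TensorProduct.tmul_smul]

/-- Isometries congruent to the identity modulo `D * N` lie in the smaller group. The class of an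
automorphism modulo `D * N` is determined by the images of finitely many generators in a finite
quotient, so there are finitely many cosets. -/
theorem extensions_relIndex_stableOrthogonalGroupPlus
    [Module.Free ℤ L] [Module.Finite ℤ L] [Module.Finite ℤ L']
    (hΛ : ∀ x, (∀ y, Λ.form x y = 0) → x = 0)
    (hι : ∀ y, ∃ n : ℤ, n ≠ 0 ∧ ∃ x, ι.toLinearMap x = n • y) :
    (ι.extensions Λ.stableOrthogonalGroupPlus).relIndex Λ'.stableOrthogonalGroupPlus ≠ 0 := by
  obtain ⟨N, hN0, hN⟩ := exists_smul_mem_of_torsion (LinearMap.range ι.toLinearMap) hι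
  obtain ⟨D, hD0, hD⟩ := exists_smul_dual_mem hΛ
  let P : Submodule ℤ L' := LinearMap.range ((D * N) • (LinearMap.id : L' →ₗ[ℤ] L'))
  have hfin : Finite (L' ⧸ P) :=
    finite_quotient_of_torsion P fun m => ⟨D * N, mul_ne_zero hD0 hN0, m, rfl⟩
  obtain ⟨s, hs⟩ := (Module.Finite.fg_top : (⊤ : Submodule ℤ L').FG)
  refine (relIndex_ne_zero_and_le_card
    (fun (g : Λ'.stableOrthogonalGroupPlus) (i : s) => P.mkQ ((g : L' ≃ₗ[ℤ] L') i))
    fun g h H => ?_).1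
  refine ι.mem_extensions_of_congruent hN hD0 hD
    (Λ'.orthogonalGroupPlus.mul_mem (inv_mem g.2.1) h.2.1) fun y => ?_
  have heq : P.mkQ ∘ₗ (h : L' ≃ₗ[ℤ] L').toLinearMap = P.mkQ ∘ₗ (g : L' ≃ₗ[ℤ] L').toLinearMap :=
    LinearMap.ext_on hs fun i hi => (congrFun H ⟨i, hi⟩).symm
  obtain ⟨t, ht⟩ := (Submodule.Quotient.eq P).mp (LinearMap.congr_fun heq y)
  have ht' : (D * N) • t = (h : L' ≃ₗ[ℤ] L') y - (g : L' ≃ₗ[ℤ] L') y := ht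
  refine ⟨(g : L' ≃ₗ[ℤ] L').symm t, ?_⟩
  change (g : L' ≃ₗ[ℤ] L').symm ((h : L' ≃ₗ[ℤ] L') y) - y = _
  rw [← map_zsmul, ht', map_sub, LinearEquiv.symm_apply_apply]

theorem exists_toSaturation_eq_smul (y : ι.saturation) :
    ∃ n : ℤ, n ≠ 0 ∧ ∃ x, ι.toSaturation.toLinearMap x = n • y := by
  obtain ⟨n, hn, x, hx⟩ := y.2
  exact ⟨n, hn, x, Subtype.ext hx⟩

theorem saturationLattice_eq_zero [Module.Free ℤ L'] (hΛ : ∀ x, (∀ y, Λ.form x y = 0) → x = 0)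
    (s : ι.saturation) (hs : ∀ t, ι.saturationLattice.form s t = 0) : s = 0 := by
  obtain ⟨n, hn, x, hx⟩ := s.2
  have hx0 : x = 0 := hΛ x fun y => by
    have h := hs (ι.toSaturation.toLinearMap y)
    change Λ'.form s (ι.toLinearMap y) = 0 at h
    rw [← ι.map_form, hx, map_smul, LinearMap.smul_apply, h, smul_zero]
  rw [hx0, map_zero] at hx
  exact Subtype.ext ((smul_eq_zero.mp hx.symm).resolve_left hn)

/-- The index of `Γ`, regarded as a group of isometries of the saturation `Λ_s`, in `O⁺(Λ_s)`. -/
theorem extensions_relIndex_saturation [Module.Free ℤ L] [Module.Finite ℤ L]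
    [Module.Free ℤ L'] [Module.Finite ℤ L'] (hΛ : ∀ x, (∀ y, Λ.form x y = 0) → x = 0)
    {Γ : Subgroup (L ≃ₗ[ℤ] L)} (hΓ : Γ.relIndex Λ.orthogonalGroupPlus ≠ 0) :
    (ι.toSaturation.extensions Γ).relIndex ι.saturationLattice.orthogonalGroupPlus ≠ 0 ∧
      (ι.toSaturation.extensions Γ).relIndex ι.saturationLattice.orthogonalGroupPlus ≤
        (Γ ⊓ Λ.stableOrthogonalGroupPlus).relIndex Λ.stableOrthogonalGroupPlus *
        (ι.toSaturation.extensions Λ.stableOrthogonalGroupPlus).relIndex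
          ι.saturationLattice.stableOrthogonalGroupPlus *
        Nat.card ι.saturationLattice.discOrthogonalGroup := by
  have hle : Λ.stableOrthogonalGroupPlus ≤ Λ.orthogonalGroupPlus := inf_le_left
  have h1 : Γ.relIndex Λ.stableOrthogonalGroupPlus ≠ 0 :=
    mt (Subgroup.relIndex_eq_zero_of_le_right hle) hΓ
  have h2 := ι.toSaturation.extensions_relIndex_extensions h1
  have h3 := ι.toSaturation.extensions_relIndex_stableOrthogonalGroupPlus hΛ
    ι.exists_toSaturation_eq_smul
  have h4 := stableOrthogonalGroupPlus_relIndex (ι.saturationLattice_eq_zero hΛ)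
  -- The chain is `Γ_s`, `Õ⁺(Λ)_s`, `Õ⁺(Λ_s)`, `O⁺(Λ_s)`.
  have h5 := relIndex_ne_zero_and_le_mul h2.1 h3 h4.1
  refine ⟨h5.1, h5.2.trans ?_⟩
  rw [Subgroup.inf_relIndex_right]
  gcongr
  · exact h2.2
  · exact h4.2

end LatticeEmbedding


/-! ### Complex conjugation and extension of scalars -/

section Conj

variable {L L' : Type*} [AddCommGroup L] [AddCommGroup L']

namespace EvenLattice

@[simp]
theorem complexConj_tmul (a : ℂ) (l : L) :
    complexConj L (a ⊗ₜ l) = (starRingEnd ℂ a) ⊗ₜ l := rfl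

theorem complexConj_smul (c : ℂ) (x : ℂ ⊗[ℤ] L) :
    complexConj L (c • x) = starRingEnd ℂ c • complexConj L x := by
  induction x using TensorProduct.induction_on with
  | zero => simp
  | add x y hx hy => rw [smul_add, map_add, hx, hy, map_add, smul_add]
  | tmul a l => simp [TensorProduct.smul_tmul']

theorem complexConj_complexConj (x : ℂ ⊗[ℤ] L) : complexConj L (complexConj L x) = x := by
  induction x using TensorProduct.induction_on with
  | zero => simp
  | add x y hx hy => rw [map_add, map_add, hx, hy]
  | tmul a l => simp

theorem complexConj_baseChange (f : L →ₗ[ℤ] L') (x : ℂ ⊗[ℤ] L) :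
    complexConj L' (f.baseChange ℂ x) = f.baseChange ℂ (complexConj L x) := by
  induction x using TensorProduct.induction_on with
  | zero => simp
  | add x y hx hy => simp only [map_add, hx, hy]
  | tmul a l => simp

theorem form_complexConj (Λ : EvenLattice L) (x y : ℂ ⊗[ℤ] L) :
    Λ.form.baseChange ℂ (complexConj L x) (complexConj L y) =
      starRingEnd ℂ (Λ.form.baseChange ℂ x y) := by
  induction x using TensorProduct.induction_on with
  | zero => simp
  | add x₁ x₂ h₁ h₂ => simp only [map_add, LinearMap.add_apply, h₁, h₂]
  | tmul a l =>
    induction y using TensorProduct.induction_on with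
    | zero => simp
    | add y₁ y₂ h₁ h₂ => simp only [map_add, h₁, h₂]
    | tmul b l' => simp [LinearMap.BilinForm.baseChange_tmul]

theorem complex_form_symm (Λ : EvenLattice L) (x y : ℂ ⊗[ℤ] L) :
    Λ.form.baseChange ℂ x y = Λ.form.baseChange ℂ y x := by
  induction x using TensorProduct.induction_on with
  | zero => simp
  | add x₁ x₂ h₁ h₂ => simp only [map_add, LinearMap.add_apply, h₁, h₂]
  | tmul a l =>
    induction y using TensorProduct.induction_on with
    | zero => simp
    | add y₁ y₂ h₁ h₂ => simp only [map_add, LinearMap.add_apply, h₁, h₂]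
    | tmul b l' =>
      simp only [LinearMap.BilinForm.baseChange_tmul]
      rw [Λ.symm l l', mul_comm a b]

/-- Rescaling by `c` multiplies `(w, w)` by `c²` and `(w, w̄)` by `|c|²`, so any representative
decides membership. -/
theorem mk_mem_periodSet_iff (Λ : EvenLattice L) {w : ℂ ⊗[ℤ] L} (hw : w ≠ 0) :
    Projectivization.mk ℂ w hw ∈ Λ.periodSet ↔
      Λ.form.baseChange ℂ w w = 0 ∧ 0 < (Λ.form.baseChange ℂ w (complexConj L w)).re := by
  refine ⟨?_, fun h => ⟨w, hw, rfl, h⟩⟩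
  rintro ⟨v, hv, h, h1, h2⟩
  obtain ⟨c, rfl⟩ := (Projectivization.mk_eq_mk_iff' ℂ _ _ hw hv).mp h
  have hc : c ≠ 0 := fun h0 => hw (by rw [h0, zero_smul])
  refine ⟨by simp [h1], ?_⟩
  have h3 : Λ.form.baseChange ℂ (c • v) (complexConj L (c • v)) =
      (Complex.normSq c : ℂ) * Λ.form.baseChange ℂ v (complexConj L v) := by
    rw [complexConj_smul, map_smul, map_smul, LinearMap.smul_apply, smul_eq_mul, smul_eq_mul,
      ← Complex.mul_conj]
    ring
  rw [h3, Complex.re_ofReal_mul]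
  exact mul_pos (Complex.normSq_pos.mpr hc) h2

theorem projMap_mem_periodSet_iff {Λ : EvenLattice L} {Λ' : EvenLattice L'} {f : L →ₗ[ℤ] L'}
    (hf : Function.Injective f) (h : ∀ x y, Λ'.form (f x) (f y) = Λ.form x y)
    (x : ℙ ℂ (ℂ ⊗[ℤ] L)) : projMap f hf x ∈ Λ'.periodSet ↔ x ∈ Λ.periodSet := by
  induction x using Projectivization.ind with
  | h v hv =>
    rw [projMap, Projectivization.map_mk, mk_mem_periodSet_iff, mk_mem_periodSet_iff,
      complexConj_baseChange, baseChange_form_map Λ.form Λ'.form f h,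
      baseChange_form_map Λ.form Λ'.form f h]

end EvenLattice

/-- The `ℂ`-linear extension of an integral linear form. -/
def complexFunctional (f : L →ₗ[ℤ] ℤ) : ℂ ⊗[ℤ] L →ₗ[ℂ] ℂ :=
  (TensorProduct.AlgebraTensorModule.rid ℤ ℂ ℂ).toLinearMap ∘ₗ f.baseChange ℂ

@[simp]
theorem complexFunctional_tmul (f : L →ₗ[ℤ] ℤ) (a : ℂ) (l : L) :
    complexFunctional f (a ⊗ₜ l) = f l * a := by
  simp [complexFunctional]

theorem complexFunctional_complexConj (f : L →ₗ[ℤ] ℤ) (x : ℂ ⊗[ℤ] L) :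
    complexFunctional f (EvenLattice.complexConj L x) = starRingEnd ℂ (complexFunctional f x) := by
  induction x using TensorProduct.induction_on with
  | zero => simp
  | add x y hx hy => simp only [map_add, hx, hy]
  | tmul a l => simp

theorem complexFunctional_baseChange (f : L' →ₗ[ℤ] ℤ) (h : L →ₗ[ℤ] L') (x : ℂ ⊗[ℤ] L) :
    complexFunctional f (h.baseChange ℂ x) = complexFunctional (f ∘ₗ h) x := by
  simp [complexFunctional, LinearMap.baseChange_comp]

/-! ### Maps between projective spaces -/

theorem projMap_injective (f : L →ₗ[ℤ] L') (hf : Function.Injective f) :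
    Function.Injective (projMap f hf) :=
  Projectivization.map_injective _ _

/-- This permits clearing denominators: a rational map acts on periods through an integral multiple.
-/
theorem projMap_eq_of_smul {f h : L →ₗ[ℤ] L'} (hf : Function.Injective f)
    (hh : Function.Injective h) {N : ℤ} (H : ∀ x, f x = N • h x)
    (x : ℙ ℂ (ℂ ⊗[ℤ] L)) : projMap f hf x = projMap h hh x := by
  induction x using Projectivization.ind with
  | h v hv =>
    rw [projMap, projMap, Projectivization.map_mk, Projectivization.map_mk,
      Projectivization.mk_eq_mk_iff']
    refine ⟨N, ?_⟩
    obtain rfl : f = N • h := LinearMap.ext H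
    rw [LinearMap.baseChange_smul, LinearMap.smul_apply, Int.cast_smul_eq_zsmul]

theorem projAct_projMap_eq {g : L' ≃ₗ[ℤ] L'} {f : L →ₗ[ℤ] L'} (hf : Function.Injective f)
    (x : ℙ ℂ (ℂ ⊗[ℤ] L)) : projAct g (projMap f hf x) =
      projMap (g.toLinearMap ∘ₗ f) (g.injective.comp hf) x :=
  (projMap_comp f hf _ g.injective _ _ (fun _ => rfl) x).symm

variable [Module.Free ℤ L] [Module.Finite ℤ L] [Module.Free ℤ L'] [Module.Finite ℤ L']

theorem continuous_projectivization_mk {X : Type*} [TopologicalSpace X] {w : X → ℂ ⊗[ℤ] L}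
    (hw : Continuous w) (h0 : ∀ x, w x ≠ 0) :
    Continuous fun x => Projectivization.mk ℂ (w x) (h0 x) :=
  (continuous_coinduced_rng (f := fun v : {v : ℂ ⊗[ℤ] L // v ≠ 0} =>
    Projectivization.mk' ℂ v)).comp (hw.subtype_mk h0)

theorem continuous_projMap (f : L →ₗ[ℤ] L') (hf : Function.Injective f) :
    Continuous (projMap f hf) := by
  refine continuous_coinduced_dom.mpr ?_
  exact continuous_projectivization_mk
    ((f.baseChange ℂ).continuous_of_finiteDimensional.comp continuous_subtype_val)
    fun v => (map_ne_zero_iff _ (baseChange_complex_injective f hf)).mpr v.2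

/-! ### Period domains are nondegenerate -/

open EvenLattice in
/-- A period domain is not contained in a rational hyperplane. -/
theorem EvenLattice.IsPeriodDomain.exists_complexFunctional_ne_zero {Λ : EvenLattice L}
    {Ω : Set (ℙ ℂ (ℂ ⊗[ℤ] L))} (hΩ : Λ.IsPeriodDomain Ω) {f : L →ₗ[ℤ] ℤ} (hf : f ≠ 0) :
    ∃ (v : ℂ ⊗[ℤ] L) (hv : v ≠ 0), Projectivization.mk ℂ v hv ∈ Ω ∧
      complexFunctional f v ≠ 0 := by
  obtain ⟨x, hx, rfl⟩ := hΩ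
  obtain ⟨w, hw, rfl, hww, hpos⟩ := id hx
  by_cases hfw : complexFunctional f w = 0
  swap
  · exact ⟨w, hw, mem_connectedComponentIn hx, hfw⟩
  obtain ⟨l, hl⟩ : ∃ l, f l ≠ 0 := by
    by_contra! h
    exact hf (LinearMap.ext h)
  set B := Λ.form.baseChange ℂ with hB
  set w' := complexConj L w with hw'
  have hsymm : ∀ x y, B x y = B y x := Λ.complex_form_symm
  have hconj : ∀ x y, B (complexConj L x) (complexConj L y) = starRingEnd ℂ (B x y) :=
    Λ.form_complexConj
  have hcw' : complexConj L w' = w := complexConj_complexConj w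
  have hw'w' : B w' w' = 0 := by rw [hw', hconj, hww, map_zero]
  have hfw' : complexFunctional f w' = 0 := by
    rw [hw', complexFunctional_complexConj, hfw, map_zero]
  obtain ⟨α, hα⟩ : ∃ α : ℝ, B w w' = α := by
    obtain ⟨α, hα⟩ := Complex.conj_eq_iff_real.mp
      (show starRingEnd ℂ (B w w') = B w w' by rw [← hconj, hcw', ← hw', hsymm])
    exact ⟨α, hα⟩
  have hα' : B w' w = α := by rw [hsymm, hα]
  have hα0 : 0 < α := by rwa [hα, Complex.ofReal_re] at hpos
  have hαC : (α : ℂ) ≠ 0 := Complex.ofReal_ne_zero.mpr hα0.ne'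
  set z : ℂ ⊗[ℤ] L := 1 ⊗ₜ l with hz
  have hcz : complexConj L z = z := by simp [hz]
  set p := B z w with hp
  have hp' : B z w' = starRingEnd ℂ p := by rw [← hconj, hcz]
  -- The component of the integral vector `z` orthogonal to `w` and `w̄`. It is real, and it has the
  -- same nonzero value under `f` as `z`, since `f` kills `w` and `w̄`.
  set e := z - (starRingEnd ℂ p / α) • w - (p / α) • w' with he
  have hew : B e w = 0 := by
    simp only [he, map_sub, map_smul, LinearMap.sub_apply, LinearMap.smul_apply, hww, hα', ← hp,
      smul_eq_mul]
    field_simp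
    ring
  have hew' : B e w' = 0 := by
    simp only [he, map_sub, map_smul, LinearMap.sub_apply, LinearMap.smul_apply, hw'w', hα, hp',
      smul_eq_mul]
    field_simp
    ring
  have hwe : B w e = 0 := by rw [hsymm, hew]
  have hw'e : B w' e = 0 := by rw [hsymm, hew']
  have hce : complexConj L e = e := by
    simp only [he, map_sub, complexConj_smul, hcz, hcw', ← hw', map_div₀, Complex.conj_conj,
      Complex.conj_ofReal]
    abel
  obtain ⟨β, hβ⟩ : ∃ β : ℝ, B e e = β :=
    Complex.conj_eq_iff_real.mp (by rw [← hconj, hce])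
  have hfe : complexFunctional f e = f l := by
    simp [he, hfw, hfw', hz]
  -- A path from `w` in the direction `e`; the coefficient of `w̄` is chosen to cancel `(s e, s e) =
  -- s² β`, so that the path stays on the quadric.
  let c : ℝ → ℂ ⊗[ℤ] L := fun s =>
    w + (s : ℂ) • e - ((s ^ 2 * β / (2 * α) : ℝ) : ℂ) • w'
  have hcc : ∀ s, B (c s) (c s) = 0 := by
    intro s
    simp only [c, map_sub, map_add, map_smul, LinearMap.sub_apply, LinearMap.add_apply,
      LinearMap.smul_apply, smul_eq_mul, hww, hw'w', hα, hα', hew, hew', hwe, hw'e, hβ]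
    push_cast
    field_simp
    ring
  have hcc' : ∀ s, (B (c s) (complexConj L (c s))).re =
      α + s ^ 2 * β + (s ^ 2 * β / (2 * α)) ^ 2 * α := by
    intro s
    simp only [c, map_sub, map_add, map_smul, complexConj_smul, hce, hcw', ← hw',
      Complex.conj_ofReal, LinearMap.sub_apply, LinearMap.add_apply,
      LinearMap.smul_apply, smul_eq_mul, hww, hw'w', hα, hα', hew, hew', hwe, hw'e, hβ]
    rw [← Complex.ofReal_re (α + s ^ 2 * β + (s ^ 2 * β / (2 * α)) ^ 2 * α)]
    congr 1
    push_cast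
    ring
  -- Small enough that `s² β` cannot outweigh `α` on `[0, r]`; the `+ 1` covers `β = 0`.
  let r := √(α / (|β| + 1))
  have hr : 0 < r := Real.sqrt_pos.mpr (by positivity)
  have hr2 : r ^ 2 * |β| < α := by
    rw [Real.sq_sqrt (by positivity), div_mul_eq_mul_div, div_lt_iff₀ (by positivity)]
    nlinarith
  have hcpos : ∀ s : Set.Icc 0 r, 0 < (B (c s) (complexConj L (c s))).re := by
    intro s
    rw [hcc']
    have h1 : (s : ℝ) ^ 2 * |β| ≤ r ^ 2 * |β| := by
      have := pow_le_pow_left₀ s.2.1 s.2.2 2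
      gcongr
    have h2 : -((s : ℝ) ^ 2 * |β|) ≤ (s : ℝ) ^ 2 * β := by
      rw [← mul_neg]
      exact mul_le_mul_of_nonneg_left (neg_abs_le β) (sq_nonneg _)
    have h3 : 0 ≤ ((s : ℝ) ^ 2 * β / (2 * α)) ^ 2 * α := by positivity
    linarith
  have hc0 : ∀ s : Set.Icc 0 r, c s ≠ 0 := by
    intro s h
    have := hcpos s
    rw [h] at this
    simp at this
  have hcont : Continuous fun s : Set.Icc 0 r => Projectivization.mk ℂ (c s) (hc0 s) := by
    refine continuous_projectivization_mk (w := fun s : Set.Icc 0 r => c s) ?_ hc0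
    fun_prop
  have : PreconnectedSpace (Set.Icc 0 r) := Subtype.preconnectedSpace isPreconnected_Icc
  have hc00 : c 0 = w := by
    simp only [c, Complex.ofReal_zero, zero_smul, add_zero, ne_eq, OfNat.ofNat_ne_zero,
      not_false_eq_true, zero_pow, zero_mul, zero_div, sub_zero]
  have hsub := (isPreconnected_range hcont).subset_connectedComponentIn (F := Λ.periodSet)
    (x := Projectivization.mk ℂ w hw)
    ⟨⟨0, le_rfl, hr.le⟩, (Projectivization.mk_eq_mk_iff' ℂ _ _ _ _).mpr ⟨1, (one_smul ℂ w).trans hc00.symm⟩⟩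
    (by
      rintro _ ⟨s, rfl⟩
      exact (Λ.mk_mem_periodSet_iff (hc0 s)).mpr ⟨hcc s, hcpos s⟩)
  refine ⟨c r, hc0 ⟨r, hr.le, le_rfl⟩, hsub ⟨⟨r, hr.le, le_rfl⟩, rfl⟩, ?_⟩
  simp [c, hfw, hfw', hfe, hr.ne', hl]

end Conj


/-! ### Analytic subsets defined by rational conditions -/

/-- Vanishing of the `2 × 2` minors expresses proportionality by polynomial equations, which is what
makes equalizers analytic. -/
theorem Projectivization.mk_eq_mk_iff_minors {V I : Type*} [AddCommGroup V] [Module ℂ V]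
    (b : Module.Basis I ℂ V) {v w : V} (hv : v ≠ 0) (hw : w ≠ 0) :
    Projectivization.mk ℂ v hv = Projectivization.mk ℂ w hw ↔
      ∀ i j, b.repr v i * b.repr w j - b.repr v j * b.repr w i = 0 := by
  rw [Projectivization.mk_eq_mk_iff']
  constructor
  · rintro ⟨c, rfl⟩ i j
    simp only [map_smul, Finsupp.smul_apply, smul_eq_mul]
    ring
  · intro h
    obtain ⟨j, hj⟩ : ∃ j, b.repr w j ≠ 0 := by
      by_contra! h0
      exact hw (b.repr.map_eq_zero_iff.mp (Finsupp.ext h0))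
    refine ⟨b.repr v j / b.repr w j, b.repr.injective (Finsupp.ext fun i => ?_)⟩
    simp only [map_smul, Finsupp.smul_apply, smul_eq_mul]
    field_simp
    linear_combination -(h i j)

section Analytic

variable {L L' : Type*} [AddCommGroup L] [AddCommGroup L']

/-- The points of `Ω` in the hyperplane defined by `f`. -/
def hyperplaneSection (Ω : Set (ℙ ℂ (ℂ ⊗[ℤ] L))) (f : L →ₗ[ℤ] ℤ) : Set (ℙ ℂ (ℂ ⊗[ℤ] L)) :=
  {x ∈ Ω | ∃ (v : ℂ ⊗[ℤ] L) (hv : v ≠ 0), x = Projectivization.mk ℂ v hv ∧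
    complexFunctional f v = 0}

theorem mk_mem_hyperplaneSection_iff {Ω : Set (ℙ ℂ (ℂ ⊗[ℤ] L))} {f : L →ₗ[ℤ] ℤ}
    {v : ℂ ⊗[ℤ] L} (hv : v ≠ 0) (hΩ : Projectivization.mk ℂ v hv ∈ Ω) :
    Projectivization.mk ℂ v hv ∈ hyperplaneSection Ω f ↔ complexFunctional f v = 0 := by
  refine ⟨?_, fun h => ⟨hΩ, v, hv, rfl, h⟩⟩
  rintro ⟨-, w, hw, h, h0⟩
  obtain ⟨c, rfl⟩ := (Projectivization.mk_eq_mk_iff' ℂ _ _ hv hw).mp h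
  rw [map_smul, h0, smul_zero]

variable [Module.Free ℤ L] [Module.Finite ℤ L] [Module.Free ℤ L']

theorem IsAnalyticSubset.of_entire {Ω A : Set (ℙ ℂ (ℂ ⊗[ℤ] L))} (hA : A ⊆ Ω)
    (𝓕 : Set (ℂ ⊗[ℤ] L → ℂ)) (h𝓕 : ∀ F ∈ 𝓕, Differentiable ℂ F)
    (h : ∀ u (hu : u ≠ 0), Projectivization.mk ℂ u hu ∈ Ω →
      (Projectivization.mk ℂ u hu ∈ A ↔ ∀ F ∈ 𝓕, F u = 0)) : IsAnalyticSubset Ω A :=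
  ⟨hA, fun _ _ _ => ⟨Set.univ, isOpen_univ, Set.mem_univ _, 𝓕,
    fun F hF => (h𝓕 F hF).differentiableOn, fun u _ hu => h u hu⟩⟩

theorem isAnalyticSubset_empty (Ω : Set (ℙ ℂ (ℂ ⊗[ℤ] L))) : IsAnalyticSubset Ω ∅ :=
  .of_entire (Set.empty_subset _) {fun _ => 1} (by simp) fun u hu _ => by simp

theorem isAnalyticSubset_hyperplaneSection (Ω : Set (ℙ ℂ (ℂ ⊗[ℤ] L))) (f : L →ₗ[ℤ] ℤ) :
    IsAnalyticSubset Ω (hyperplaneSection Ω f) := by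
  refine .of_entire (fun _ hx => hx.1) {⇑(complexFunctional f)} ?_ fun u hu h => ?_
  · rintro _ rfl
    exact (LinearMap.toContinuousLinearMap (complexFunctional f)).differentiable
  · simpa using mk_mem_hyperplaneSection_iff hu h

/-- The points of `Ω` where the maps induced by `f` and `h` agree. -/
def equalizerSection (Ω : Set (ℙ ℂ (ℂ ⊗[ℤ] L))) {f h : L →ₗ[ℤ] L'} (hf : Function.Injective f)
    (hh : Function.Injective h) : Set (ℙ ℂ (ℂ ⊗[ℤ] L)) :=
  {x ∈ Ω | projMap f hf x = projMap h hh x}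

theorem isAnalyticSubset_equalizerSection (Ω : Set (ℙ ℂ (ℂ ⊗[ℤ] L))) {f h : L →ₗ[ℤ] L'}
    (hf : Function.Injective f) (hh : Function.Injective h) :
    IsAnalyticSubset Ω (equalizerSection Ω hf hh) := by
  let b := (Module.Free.chooseBasis ℤ L').baseChange ℂ
  let φ : (L →ₗ[ℤ] L') → Module.Free.ChooseBasisIndex ℤ L' → ℂ ⊗[ℤ] L →ₗ[ℂ] ℂ :=
    fun f i => b.coord i ∘ₗ f.baseChange ℂ
  have hd : ∀ f i, Differentiable ℂ fun u => φ f i u := fun f i =>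
    (LinearMap.toContinuousLinearMap (φ f i)).differentiable
  refine .of_entire (fun _ hx => hx.1)
    (Set.range fun p : _ × _ => fun u => φ f p.1 u * φ h p.2 u - φ f p.2 u * φ h p.1 u) ?_
    fun u hu hΩ => ?_
  · rintro _ ⟨p, rfl⟩
    exact ((hd f p.1).mul (hd h p.2)).sub ((hd f p.2).mul (hd h p.1))
  · have h1 : Projectivization.mk ℂ u hu ∈ equalizerSection Ω hf hh ↔
        projMap f hf (Projectivization.mk ℂ u hu) = projMap h hh (Projectivization.mk ℂ u hu) :=
      ⟨fun H => H.2, fun H => ⟨hΩ, H⟩⟩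
    rw [h1, projMap, projMap, Projectivization.map_mk, Projectivization.map_mk,
      Projectivization.mk_eq_mk_iff_minors b, Set.forall_mem_range, Prod.forall]
    rfl

theorem countable_linearMap [Module.Finite ℤ L'] : Countable (L →ₗ[ℤ] L') :=
  (Module.Free.chooseBasis ℤ (L →ₗ[ℤ] L')).equivFun.injective.countable

theorem countable_linearEquiv : Countable (L ≃ₗ[ℤ] L) :=
  have := countable_linearMap (L := L) (L' := L)
  LinearEquiv.toLinearMap_injective.countable

end Analytic

/-! ### Isometries relating points of the period domain -/

namespace LatticeEmbedding

open EvenLattice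

variable {L L' : Type*} [AddCommGroup L] [AddCommGroup L']
  {Λ : EvenLattice L} {Λ' : EvenLattice L'} (ι : LatticeEmbedding Λ Λ')

theorem projAct_onPeriods {γ : L ≃ₗ[ℤ] L} {g : L' ≃ₗ[ℤ] L'}
    (h : ∀ x, g (ι.toLinearMap x) = ι.toLinearMap (γ x)) (x : ℙ ℂ (ℂ ⊗[ℤ] L)) :
    projAct g (ι.onPeriods x) = ι.onPeriods (projAct γ x) := by
  have hc : Function.Injective (g.toLinearMap ∘ₗ ι.toLinearMap) := g.injective.comp ι.injective
  exact (projMap_comp ι.toLinearMap ι.injective g.toLinearMap g.injective _ hc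
    (fun _ => rfl) x).symm.trans
    (projMap_comp γ.toLinearMap γ.injective ι.toLinearMap ι.injective _ hc h x)

theorem onPeriods_injective : Function.Injective ι.onPeriods := projMap_injective _ _

theorem projAct_inv_eq {g : L ≃ₗ[ℤ] L} {x y : ℙ ℂ (ℂ ⊗[ℤ] L)} (h : projAct g x = y) :
    projAct g⁻¹ y = x := by
  rw [← h, ← projAct_mul, inv_mul_cancel, projAct_one]

/-- Being finitely generated and torsion free, the quotient is free, so integral linear forms detect
whether a vector lies in the saturation. -/
theorem quotient_saturation_isTorsionFree : Module.IsTorsionFree ℤ (L' ⧸ ι.saturation) := by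
  refine .of_smul_eq_zero fun n q h => or_iff_not_imp_left.mpr fun hn => ?_
  obtain ⟨y, rfl⟩ := ι.saturation.mkQ_surjective q
  rw [← map_smul] at h
  obtain ⟨k, hk, x, hx⟩ := (Submodule.Quotient.mk_eq_zero _).mp h
  exact (Submodule.Quotient.mk_eq_zero _).mpr
    ⟨k * n, mul_ne_zero hk hn, x, by rw [hx, smul_smul]⟩

/-- If an isometry of `Λ'` maps a point of `Ω` outside of all rational hyperplanes into `ℙ(Λ ⊗ ℂ)`,
then it preserves the saturation of `Λ`. -/
theorem map_saturation_eq [Module.Finite ℤ L'] {Ω : Set (ℙ ℂ (ℂ ⊗[ℤ] L))} {x : ℙ ℂ (ℂ ⊗[ℤ] L)} (hx : x ∈ Ω)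
    (hgen : ∀ f : L →ₗ[ℤ] ℤ, f ≠ 0 → x ∉ hyperplaneSection Ω f) {g : L' ≃ₗ[ℤ] L'}
    {y : ℙ ℂ (ℂ ⊗[ℤ] L)} (hxy : projAct g (ι.onPeriods x) = ι.onPeriods y) :
    ι.saturation.map g.toLinearMap = ι.saturation := by
  have htf := ι.quotient_saturation_isTorsionFree
  have hfree : Module.Free ℤ (L' ⧸ ι.saturation) := Module.free_iff_isTorsionFree.mpr htf
  -- Otherwise some form `f` on `L'` kills `Λ` but not `g(Λ)`. Its pullback along `g ∘ ι` is then
  -- nonzero, yet vanishes at `x` because `g` sends `ι(x)` to `ι(y)`: a rational hyperplane through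
  -- `x`.
  have h1 : ∀ l, g (ι.toLinearMap l) ∈ ι.saturation := by
    by_contra! h
    obtain ⟨l, hl⟩ := h
    rw [← Submodule.Quotient.mk_eq_zero, ← Module.forall_dual_apply_eq_zero_iff ℤ] at hl
    push Not at hl
    obtain ⟨φ, hφ⟩ := hl
    set f : L' →ₗ[ℤ] ℤ := φ ∘ₗ ι.saturation.mkQ
    have hf0 : f ∘ₗ ι.toLinearMap = 0 := by
      refine LinearMap.ext fun z => ?_
      have hz : ι.saturation.mkQ (ι.toLinearMap z) = 0 :=
        (Submodule.Quotient.mk_eq_zero _).mpr ⟨1, one_ne_zero, z, (one_smul ℤ _).symm⟩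
      simp only [f, LinearMap.comp_apply, hz, map_zero, LinearMap.zero_apply]
    refine hgen (f ∘ₗ g.toLinearMap ∘ₗ ι.toLinearMap)
      (fun h0 => hφ (LinearMap.congr_fun h0 l)) ?_
    induction x using Projectivization.ind with
    | h v hv =>
      induction y using Projectivization.ind with
      | h u hu =>
        rw [mk_mem_hyperplaneSection_iff hv hx]
        obtain ⟨c, hc⟩ := (Projectivization.mk_eq_mk_iff' ℂ _ _ _ _).mp hxy
        rw [← complexFunctional_baseChange, LinearMap.baseChange_comp]
        change complexFunctional f (g.toLinearMap.baseChange ℂ (ι.toLinearMap.baseChange ℂ v)) = 0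
        have hc' : c • ι.toLinearMap.baseChange ℂ u =
          g.toLinearMap.baseChange ℂ (ι.toLinearMap.baseChange ℂ v) := hc
        rw [← hc', map_smul, complexFunctional_baseChange, hf0]
        simp [complexFunctional]
  have h2 : ι.saturation ≤ ι.saturation.comap g.toLinearMap := by
    rintro s ⟨n, hn, l, hl⟩
    obtain ⟨k, hk, l', hl'⟩ := h1 l
    refine ⟨k * n, mul_ne_zero hk hn, l', ?_⟩
    rw [hl', hl, mul_smul]
    exact congrArg (k • ·) (map_smul g n s)
  -- For the reverse inclusion: the endomorphism of the Noetherian quotient induced by `g` is onto,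
  -- hence injective, so `g s` in the saturation forces `s` into it.
  have h3 : Function.Injective (ι.saturation.mapQ ι.saturation g.toLinearMap h2) := by
    apply IsNoetherian.injective_of_surjective_endomorphism
    intro q
    obtain ⟨z, rfl⟩ := ι.saturation.mkQ_surjective q
    exact ⟨ι.saturation.mkQ (g.symm z), congrArg ι.saturation.mkQ (g.apply_symm_apply z)⟩
  apply le_antisymm (Submodule.map_le_iff_le_comap.mpr h2)
  intro s hs
  refine ⟨g.symm s, ?_, g.apply_symm_apply s⟩
  refine (Submodule.Quotient.mk_eq_zero ι.saturation).mp (h3 ?_)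
  rw [map_zero]
  refine (Submodule.Quotient.mk_eq_zero ι.saturation).mpr ?_
  change g (g.symm s) ∈ _
  rwa [g.apply_symm_apply]

/-- An isometry of `Λ'` which preserves the saturation of `Λ` and maps one point of `Ω` into `Ω`
maps `Ω` into `Ω`. -/
theorem exists_onPeriods_eq [Module.Free ℤ L] [Module.Finite ℤ L] [Module.Free ℤ L']
    [Module.Finite ℤ L'] {Ω : Set (ℙ ℂ (ℂ ⊗[ℤ] L))} (hΩ : Λ.IsPeriodDomain Ω)
    {g : L' ≃ₗ[ℤ] L'} (hg : g ∈ Λ'.orthogonalGroup)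
    (hs : ι.saturation.map g.toLinearMap = ι.saturation) {x y : ℙ ℂ (ℂ ⊗[ℤ] L)} (hx : x ∈ Ω)
    (hy : y ∈ Ω) (hxy : projAct g (ι.onPeriods x) = ι.onPeriods y) {z : ℙ ℂ (ℂ ⊗[ℤ] L)}
    (hz : z ∈ Ω) : ∃ z' ∈ Ω, projAct g (ι.onPeriods z) = ι.onPeriods z' := by
  obtain ⟨N, hN0, hN⟩ := exists_smul_mem_of_torsion
    (LinearMap.range ι.toSaturation.toLinearMap) ι.exists_toSaturation_eq_smul
  have hmem : ∀ l, (N • (g.toLinearMap ∘ₗ ι.toLinearMap)) l ∈ LinearMap.range ι.toLinearMap := by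
    intro l
    have hl : g (ι.toLinearMap l) ∈ ι.saturation := by
      rw [← hs]
      exact ⟨_, ⟨1, one_ne_zero, l, (one_smul ℤ _).symm⟩, rfl⟩
    obtain ⟨l', hl'⟩ := hN ⟨_, hl⟩
    exact ⟨l', congrArg Subtype.val hl'⟩
  -- On `Λ ⊗ ℚ` the map `g` may have denominators; `h` is `N` times it and acts identically on
  -- periods.
  let h : L →ₗ[ℤ] L := (LinearEquiv.ofInjective ι.toLinearMap ι.injective).symm.toLinearMap ∘ₗ
    LinearMap.codRestrict _ _ hmem
  have hh : ∀ l, ι.toLinearMap (h l) = N • g (ι.toLinearMap l) := fun l =>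
    congrArg Subtype.val ((LinearEquiv.ofInjective ι.toLinearMap ι.injective).apply_symm_apply
      (LinearMap.codRestrict _ _ hmem l))
  have hinj : Function.Injective h := by
    intro a b hab
    have := congrArg ι.toLinearMap hab
    rw [hh, hh] at this
    exact ι.injective (g.injective (smul_right_injective L' hN0 this))
  have hproj : ∀ z, ι.onPeriods (projMap h hinj z) = projAct g (ι.onPeriods z) := by
    intro z
    change projMap ι.toLinearMap ι.injective (projMap h hinj z) =
      projAct g (projMap ι.toLinearMap ι.injective z)
    rw [projAct_projMap_eq,
      ← projMap_comp h hinj ι.toLinearMap ι.injective (ι.toLinearMap ∘ₗ h)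
        (ι.injective.comp hinj) (fun _ => rfl)]
    exact projMap_eq_of_smul _ _ hh z
  have hper : ∀ z ∈ Λ.periodSet, projMap h hinj z ∈ Λ.periodSet := by
    intro z hz
    rw [← projMap_mem_periodSet_iff (Λ' := Λ') ι.injective ι.map_form]
    change ι.onPeriods (projMap h hinj z) ∈ _
    rw [hproj]
    exact (projMap_mem_periodSet_iff g.injective hg _).mpr
      ((projMap_mem_periodSet_iff ι.injective ι.map_form z).mpr hz)
  refine ⟨projMap h hinj z, ?_, (hproj z).symm⟩
  obtain ⟨x₀, hx₀, rfl⟩ := hΩ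
  have hxy' : projMap h hinj x = y := ι.onPeriods_injective ((hproj x).trans hxy)
  -- The image of `Ω` is connected, lies in the period set and contains `y`, so it stays in the
  -- component of `y`.
  rw [connectedComponentIn_eq hy]
  refine (isPreconnected_connectedComponentIn.image _
    (continuous_projMap h hinj).continuousOn).subset_connectedComponentIn
    ⟨x, hx, hxy'⟩ ?_ ⟨z, hz, rfl⟩
  rintro _ ⟨w, hw, rfl⟩
  exact hper w (connectedComponentIn_subset _ _ hw)

end LatticeEmbedding


/-! ### Very general fibres -/

namespace LatticeEmbedding

open EvenLattice

variable {L L' : Type*} [AddCommGroup L] [AddCommGroup L']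
  {Λ : EvenLattice L} {Λ' : EvenLattice L'} (ι : LatticeEmbedding Λ Λ')

/-- A point of `Ω` is very general if it lies on no rational hyperplane and if each automorphism of
`L'` which fixes its image fixes the image of `Ω` pointwise. -/
structure IsVeryGeneral (Ω : Set (ℙ ℂ (ℂ ⊗[ℤ] L))) (x : ℙ ℂ (ℂ ⊗[ℤ] L)) : Prop where
  notMem_hyperplaneSection : ∀ f : L →ₗ[ℤ] ℤ, f ≠ 0 → x ∉ hyperplaneSection Ω f
  fixes : ∀ k : L' ≃ₗ[ℤ] L', projAct k (ι.onPeriods x) = ι.onPeriods x →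
    ∀ z ∈ Ω, projAct k (ι.onPeriods z) = ι.onPeriods z

theorem exists_analyticSubsets [Module.Free ℤ L] [Module.Finite ℤ L] [Module.Free ℤ L']
    [Module.Finite ℤ L'] {Ω : Set (ℙ ℂ (ℂ ⊗[ℤ] L))} (hΩ : Λ.IsPeriodDomain Ω) :
    ∃ A : ℕ → Set (ℙ ℂ (ℂ ⊗[ℤ] L)), (∀ n, IsAnalyticSubset Ω (A n) ∧ A n ≠ Ω) ∧
      ∀ x ∈ Ω, (∀ n, x ∉ A n) → ι.IsVeryGeneral Ω x := by
  have := countable_linearMap (L := L) (L' := ℤ)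
  have := countable_linearEquiv (L := L')
  let E : (L' ≃ₗ[ℤ] L') → Set (ℙ ℂ (ℂ ⊗[ℤ] L)) := fun k =>
    equalizerSection Ω (f := k.toLinearMap ∘ₗ ι.toLinearMap) (k.injective.comp ι.injective)
      ι.injective
  -- The empty set guarantees a nonempty family, so that a sequence enumerates it. Fixed loci equal
  -- to all of `Ω` are left out, as they impose no condition.
  let 𝒜 : Set (Set (ℙ ℂ (ℂ ⊗[ℤ] L))) := insert ∅
    (hyperplaneSection Ω '' {f | f ≠ 0} ∪ E '' {k | E k ≠ Ω})
  have hc : 𝒜.Countable := (((Set.to_countable _).image _).union ((Set.to_countable _).image _)).insert _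
  obtain ⟨A, hA⟩ := hc.exists_eq_range (Set.insert_nonempty _ _)
  have hmem : ∀ n, A n ∈ 𝒜 := fun n => hA ▸ Set.mem_range_self n
  refine ⟨A, fun n => ?_, fun x hx hxA => ?_⟩
  · rcases hmem n with h | ⟨f, hf, h⟩ | ⟨k, hk, h⟩
    · rw [h]
      refine ⟨isAnalyticSubset_empty Ω, fun h0 => ?_⟩
      obtain ⟨x, hx, rfl⟩ := hΩ
      exact h0.symm.subset (mem_connectedComponentIn hx)
    · rw [← h]
      refine ⟨isAnalyticSubset_hyperplaneSection Ω f, fun h0 => ?_⟩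
      obtain ⟨v, hv, hvΩ, hfv⟩ := hΩ.exists_complexFunctional_ne_zero hf
      exact hfv ((mk_mem_hyperplaneSection_iff hv hvΩ).mp (h0.symm.subset hvΩ))
    · rw [← h]
      exact ⟨isAnalyticSubset_equalizerSection Ω _ _, hk⟩
  · have hx𝒜 : ∀ S ∈ 𝒜, x ∉ S := by
      rw [hA]
      rintro _ ⟨n, rfl⟩
      exact hxA n
    have hE : ∀ k z, z ∈ E k ↔ z ∈ Ω ∧ projAct k (ι.onPeriods z) = ι.onPeriods z := by
      intro k z
      change z ∈ Ω ∧ _ ↔ z ∈ Ω ∧ projAct k (projMap ι.toLinearMap ι.injective z) = _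
      rw [projAct_projMap_eq]
      rfl
    refine ⟨fun f hf => hx𝒜 _ (.inr (.inl ⟨f, hf, rfl⟩)), fun k hk z hz => ?_⟩
    by_contra hkz
    refine hx𝒜 (E k) (.inr (.inr ⟨k, fun h0 => hkz ?_, rfl⟩)) ((hE k x).mpr ⟨hx, hk⟩)
    exact ((hE k z).mp (h0.symm.subset hz)).2

/-- The elements of `O⁺(Λ')` which preserve the saturation of `Λ` and the image of `Ω`. -/
def stabilizerSet (Ω : Set (ℙ ℂ (ℂ ⊗[ℤ] L))) : Set (L' ≃ₗ[ℤ] L') :=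
  {g | g ∈ Λ'.orthogonalGroupPlus ∧ ι.saturation.map g.toLinearMap = ι.saturation ∧
    ∀ z : Ω, ∃ z' : Ω, projAct g (ι.onPeriods z) = ι.onPeriods z'}

variable {Ω : Set (ℙ ℂ (ℂ ⊗[ℤ] L))}

/-- The action of `stabilizerSet` on `Ω`. -/
def move (g : ι.stabilizerSet Ω) (z : Ω) : Ω := (g.2.2.2 z).choose

theorem projAct_eq_move (g : ι.stabilizerSet Ω) (z : Ω) :
    projAct (g : L' ≃ₗ[ℤ] L') (ι.onPeriods z) = ι.onPeriods (ι.move g z) :=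
  (g.2.2.2 z).choose_spec

variable (Γ : Subgroup (L ≃ₗ[ℤ] L))

/-- The orbit of a point of `Ω` under `stabilizerSet`, as a subset of `Ω / Γ`. -/
def orbitClass (x : Ω) (g : ι.stabilizerSet Ω) : PeriodSpace Ω Γ :=
  Quotient.mk (periodSetoid Ω Γ) (ι.move g x)

/-- The maps `Ω → Ω / Γ` induced by two elements of `stabilizerSet` agree since the elements differ
by an extension of an element of `Γ`. -/
def OrbitRel (g₁ g₂ : ι.stabilizerSet Ω) : Prop :=
  ∃ γ ∈ Γ, ∃ γ' ∈ Λ'.orthogonalGroupPlus, (∀ l, γ' (ι.toLinearMap l) = ι.toLinearMap (γ l)) ∧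
    ∀ z ∈ Ω, projAct γ' (projAct (g₁ : L' ≃ₗ[ℤ] L') (ι.onPeriods z)) =
      projAct (g₂ : L' ≃ₗ[ℤ] L') (ι.onPeriods z)

variable {Γ}

theorem OrbitRel.orbitClass_eq {g₁ g₂ : ι.stabilizerSet Ω} (h : ι.OrbitRel Γ g₁ g₂) (x : Ω) :
    ι.orbitClass Γ x g₁ = ι.orbitClass Γ x g₂ := by
  obtain ⟨γ, hγ, γ', -, hγγ', hz⟩ := h
  refine Quotient.sound ⟨γ, hγ, ι.onPeriods_injective ?_⟩
  rw [← ι.projAct_onPeriods hγγ', ← projAct_eq_move, ← projAct_eq_move, hz x x.2]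

/-- The right-hand side does not involve `x`: this is why the fibre cardinality is constant. If `γ'
g₁` and `g₂` agree at `ι(x)`, then `g₂⁻¹ γ' g₁` fixes `ι(x)`, hence all of `ι(Ω)`. -/
theorem orbitClass_eq_iff (hext : ι.IsExtendable Γ) {x : Ω} (hx : ι.IsVeryGeneral Ω x)
    (g₁ g₂ : ι.stabilizerSet Ω) :
    ι.orbitClass Γ x g₁ = ι.orbitClass Γ x g₂ ↔ ι.OrbitRel Γ g₁ g₂ := by
  refine ⟨fun h => ?_, fun h => h.orbitClass_eq ι x⟩
  obtain ⟨γ, hγ, h1⟩ := Quotient.exact h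
  obtain ⟨γ', hγ', hγγ'⟩ := hext γ hγ
  refine ⟨γ, hγ, γ', hγ', hγγ', fun z hz => ?_⟩
  have h2 : projAct γ' (projAct (g₁ : L' ≃ₗ[ℤ] L') (ι.onPeriods x)) =
      projAct (g₂ : L' ≃ₗ[ℤ] L') (ι.onPeriods x) := by
    rw [projAct_eq_move, projAct_eq_move, ι.projAct_onPeriods hγγ', h1]
  have h3 := hx.fixes ((g₂ : L' ≃ₗ[ℤ] L')⁻¹ * (γ' * g₁))
    (by rw [projAct_mul, projAct_mul, h2]; exact projAct_inv_eq rfl) z hz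
  rw [projAct_mul, projAct_mul] at h3
  rw [← projAct_inv_eq h3, inv_inv]

theorem fibre_eq_range [Module.Free ℤ L] [Module.Finite ℤ L] [Module.Free ℤ L']
    [Module.Finite ℤ L'] (hΩ : Λ.IsPeriodDomain Ω) (hext : ι.IsExtendable Γ)
    {Ω' : Set (ℙ ℂ (ℂ ⊗[ℤ] L'))} (hΩΩ' : Set.MapsTo ι.onPeriods Ω Ω') {x : Ω}
    (hx : ι.IsVeryGeneral Ω x) :
    ι.periodMap hext hΩΩ' ⁻¹' {ι.periodMap hext hΩΩ' (Quotient.mk (periodSetoid Ω Γ) x)} =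
      Set.range (ι.orbitClass Γ x) := by
  apply Set.Subset.antisymm
  · intro q hq
    induction q using Quotient.inductionOn with
    | h y =>
      obtain ⟨g, hg, h⟩ := Quotient.exact hq
      have hxy : projAct g⁻¹ (ι.onPeriods x) = ι.onPeriods y := projAct_inv_eq h
      have hg' : g⁻¹ ∈ Λ'.orthogonalGroupPlus := inv_mem hg
      -- The element is inverted first, so that it starts from `x`, the point known to avoid
      -- rational hyperplanes.
      have hs := ι.map_saturation_eq x.2 hx.notMem_hyperplaneSection hxy
      refine ⟨⟨g⁻¹, hg', hs, fun z => ?_⟩, ?_⟩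
      · obtain ⟨z', hz', h⟩ := ι.exists_onPeriods_eq hΩ hg'.1 hs x.2 y.2 hxy z.2
        exact ⟨⟨z', hz'⟩, h⟩
      · refine congrArg (Quotient.mk (periodSetoid Ω Γ))
          (Subtype.ext (ι.onPeriods_injective ?_))
        rw [← projAct_eq_move]
        exact hxy
  · rintro _ ⟨g, rfl⟩
    exact Quotient.sound ⟨(g : L' ≃ₗ[ℤ] L')⁻¹, inv_mem g.2.1,
      projAct_inv_eq (ι.projAct_eq_move g x)⟩

/-- The embedding `Λ_s ↪ Λ'` of the saturation. -/
def ofSaturation : LatticeEmbedding ι.saturationLattice Λ' where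
  toLinearMap := ι.saturation.subtype
  injective := Subtype.val_injective
  map_form _ _ := rfl

/-- Elements whose restrictions to `Λ_s` differ on the left by `Γ_s` are related by `OrbitRel`. The
converse is not needed: elements such as `-1` act trivially on periods, so the index is only an
upper bound. -/
theorem finite_quot_orbitRel_and_card_le
    (hfin : (ι.toSaturation.extensions Γ).relIndex
      ι.saturationLattice.orthogonalGroupPlus ≠ 0) :
    Finite (Quot (ι.OrbitRel Γ (Ω := Ω))) ∧ Nat.card (Quot (ι.OrbitRel Γ (Ω := Ω))) ≤
      (ι.toSaturation.extensions Γ).relIndex ι.saturationLattice.orthogonalGroupPlus := by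
  set O := ι.saturationLattice.orthogonalGroupPlus
  have hf : Finite (O ⧸ (ι.toSaturation.extensions Γ).subgroupOf O) :=
    Nat.finite_of_card_ne_zero hfin
  have hres : ∀ g : ι.stabilizerSet Ω, ∃ r : O, ∀ s : ι.saturation,
      (g : L' ≃ₗ[ℤ] L') s = ((r : ι.saturation ≃ₗ[ℤ] ι.saturation) s : L') := by
    intro g
    obtain ⟨r, hr⟩ := exists_restriction ι.ofSaturation.injective (g : L' ≃ₗ[ℤ] L')
      (by simpa [ofSaturation] using g.2.2.1)
    exact ⟨⟨r, mem_orthogonalGroupPlus_of_extends ι.ofSaturation g.2.1 hr⟩, hr⟩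
  choose r hr using hres
  choose g hg using Quot.exists_rep (r := ι.OrbitRel Γ (Ω := Ω))
  -- `Γ` acts after the isometry, while the quotient consists of left cosets; inverting reconciles
  -- the two.
  let φ : Quot (ι.OrbitRel Γ (Ω := Ω)) → O ⧸ (ι.toSaturation.extensions Γ).subgroupOf O :=
    fun q => QuotientGroup.mk (r (g q))⁻¹
  have hφ : Function.Injective φ := by
    intro q₁ q₂ h
    have hmem : (r (g q₁))⁻¹⁻¹ * (r (g q₂))⁻¹ ∈ (ι.toSaturation.extensions Γ).subgroupOf O :=
      QuotientGroup.eq.mp h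
    obtain ⟨γ, hγ, H⟩ := hmem
    rw [inv_inv] at H
    rw [← hg q₁, ← hg q₂]
    refine (Quot.sound ⟨γ, hγ, (g q₁ : L' ≃ₗ[ℤ] L') * (g q₂ : L' ≃ₗ[ℤ] L')⁻¹,
      mul_mem (g q₁).2.1 (inv_mem (g q₂).2.1), fun l => ?_, fun z _ => ?_⟩).symm
    · have H' := congrArg Subtype.val (H l)
      change (((r (g q₁) : ι.saturation ≃ₗ[ℤ] ι.saturation)
        ((r (g q₂) : ι.saturation ≃ₗ[ℤ] ι.saturation).symm
          (ι.toSaturation.toLinearMap l)) : ι.saturation) : L') = ι.toLinearMap (γ l) at H'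
      rw [← H', ← hr]
      refine congrArg (g q₁ : L' ≃ₗ[ℤ] L') ((LinearEquiv.symm_apply_eq _).mpr ?_)
      rw [hr, LinearEquiv.apply_symm_apply]
      rfl
    · rw [projAct_mul, projAct_inv_eq rfl]
  exact ⟨Finite.of_injective φ hφ, Nat.card_le_card_of_injective φ hφ⟩

theorem encard_range_orbitClass (hext : ι.IsExtendable Γ) {x : Ω} (hx : ι.IsVeryGeneral Ω x) :
    (Set.range (ι.orbitClass Γ x)).encard = ENat.card (Quot (ι.OrbitRel Γ (Ω := Ω))) := by
  let F : Quot (ι.OrbitRel Γ (Ω := Ω)) → PeriodSpace Ω Γ :=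
    Quot.lift (ι.orbitClass Γ x) fun _ _ h => h.orbitClass_eq ι x
  have hF : Function.Injective F := by
    rintro ⟨g₁⟩ ⟨g₂⟩ h
    exact Quot.sound ((ι.orbitClass_eq_iff hext hx g₁ g₂).mp h)
  have hrange : Set.range F = Set.range (ι.orbitClass Γ x) := Set.range_quot_lift _
  rw [← hrange]
  exact ENat.card_congr (Equiv.ofInjective F hF).symm

end LatticeEmbedding

end

/-! ### The degree bound -/

theorem lemma2p9 {L L' : Type*}
    [AddCommGroup L] [Module.Free ℤ L] [Module.Finite ℤ L]
    [AddCommGroup L'] [Module.Free ℤ L'] [Module.Finite ℤ L']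
    (Λ : EvenLattice L) (Λ' : EvenLattice L') (m m' : ℕ) (hm : 3 ≤ m)
    (hΛ : Λ.HasSignature 2 m) (hΛ' : Λ'.HasSignature 2 m')
    (ι : LatticeEmbedding Λ Λ')
    (Ω : Set (ℙ ℂ (ℂ ⊗[ℤ] L))) (hΩ : Λ.IsPeriodDomain Ω)
    (Ω' : Set (ℙ ℂ (ℂ ⊗[ℤ] L'))) (hΩ' : Λ'.IsPeriodDomain Ω')
    (hΩΩ' : Set.MapsTo ι.onPeriods Ω Ω')
    (Γ : Subgroup (L ≃ₗ[ℤ] L)) (hΓ : Γ ≤ Λ.orthogonalGroupPlus)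
    (hfin : Γ.IsFiniteRelIndex Λ.orthogonalGroupPlus) (hext : ι.IsExtendable Γ) :
    ∃ d : ℕ, HasDegreeOntoImage (ι.periodMap hext hΩΩ') d ∧
      d ≤ (Γ ⊓ Λ.stableOrthogonalGroupPlus).relIndex Λ.stableOrthogonalGroupPlus *
        (ι.toSaturation.extensions Λ.stableOrthogonalGroupPlus).relIndex
          ι.saturationLattice.stableOrthogonalGroupPlus *
        Nat.card ι.saturationLattice.discOrthogonalGroup := by
  have hnd := hΛ.eq_zero_of_form_eq_zero
  have hidx := ι.extensions_relIndex_saturation hnd hfin.relIndex_ne_zero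
  have hquot := ι.finite_quot_orbitRel_and_card_le (Γ := Γ) (Ω := Ω) hidx.1
  have := hquot.1
  obtain ⟨A, hA, hgen⟩ := ι.exists_analyticSubsets hΩ
  refine ⟨Nat.card (Quot (ι.OrbitRel Γ (Ω := Ω))), ⟨A, hA, fun x hx => ?_⟩,
    hquot.2.trans hidx.2⟩
  have hvg := hgen x x.2 hx
  rw [ι.fibre_eq_range hΩ hext hΩΩ' hvg, ι.encard_range_orbitClass hext hvg]
  exact ENat.card_eq_coe_natCard _
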